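/- Let $0<\alpha\le 1$ and $p\ge 1$. Let $\mathbf T=(t_{ij})$ be a $p\times p$ sub-intensity matrix, i.e. $\lambda_i:=-t_{ii}>0$, $t_{ij}\ge 0$ for $i\ne j$, and $\mathbf t:=-\mathbf T\mathbf e\ge 0$, where $\mathbf e$ is the column vector of ones. Let $\boldsymbol\pi$ be a probability vector on $\{1,\dots,p\}$. Let $(J_n)_{n\ge 0}$ be the Markov chain on $\{1,\dots,p+1\}$ with initial distribution $(\boldsymbol\pi,0)$ and transition probabilities $q_{ii}=0$, $q_{ij}=t_{ij}/\lambda_i$ ($i\neq j$), $q_{i,p+1}=t_i/\lambda_i$ for $i,j\le p$, with $p+1$ absorbing; assume that the states $1,\dots,p$ are transient (equivalently, $p+1$ can be reached from each of them). Let $H^i_n$ ($i\le p$, $n\ge 0$) be independent random variables, independent of the chain, where $H^i_n$ has the Mittag-Leffler density $$\lambda_i x^{\alpha-1}\sum_{k\ge 0}\frac{(-\lambda_i x^{\alpha})^k}{\Gamma(\alpha k+\alpha)},\qquad x>0 .$$ Let $S_0=0$ and $S_{n+1}=S_n+H^{J_n}_n$ (with $S_{n+1}=\infty$ if $J_n=p+1$),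 and let $X_t=J_n$ for $S_n\le t<S_{n+1}$. Let $\tau=\inf\{t\ge 0: X_t=p+1\}$, so that $\tau\sim \mathrm{PH}_\alpha(\boldsymbol\pi,\mathbf T)$. Here, for a sub-intensity matrix $\mathbf S$ with transient states and a nonnegative vector $\boldsymbol\beta$ with $\boldsymbol\beta\mathbf e\le 1$, $\mathrm{PH}_\alpha(\boldsymbol\beta,\mathbf S)$ denotes the measure on $[0,\infty)$ of total mass $\boldsymbol\beta\mathbf e$ with Laplace transform $u\mapsto\boldsymbol\beta(u^\alpha\mathbf I-\mathbf S)^{-1}(-\mathbf S\mathbf e)$, $u\ge 0$. Let $\mathbf r=(r_1,\dots,r_p)$ be a non-zero vector of nonnegative rewards and let $$Y=\int_0^\tau\sum_{i=1}^p r_i 1\{X_t=i\}\,dt .$$ Let $E_+=\{i\le p: r_i>0\}$, $E_0=\{i\le p: r_i=0\}$, decompose $\boldsymbol\pi=(\boldsymbol\pi_+,\boldsymbol\pi_0)$ and $\mathbf T=\begin{pmatrix}\mathbf T_{++}&\mathbf T_{+0}\\ \mathbf T_{0+}&\mathbf T_{00}\end{pmatrix}$ accordingly, and let $\boldsymbol\Delta(\mathbf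 r_+^\alpha)$ be the diagonal matrix with entries $r_i^\alpha$, $i\in E_+$. Then $\mathbf T_{00}$ is invertible, and with $$\tilde{\boldsymbol\pi}=\boldsymbol\pi_++\boldsymbol\pi_0(-\mathbf T_{00})^{-1}\mathbf T_{0+},\qquad \tilde{\mathbf T}=\boldsymbol\Delta(\mathbf r_+^\alpha)^{-1}\left(\mathbf T_{++}+\mathbf T_{+0}(-\mathbf T_{00})^{-1}\mathbf T_{0+}\right),$$ $\tilde{\boldsymbol\pi}$ is nonnegative with $\tilde{\boldsymbol\pi}\mathbf e\le 1$, $\tilde{\mathbf T}$ is a sub-intensity matrix with transient states, $u^\alpha\mathbf I-\tilde{\mathbf T}$ is invertible for every $u\ge 0$, $Y$ is almost surely finite, and the law of $Y$ is the sum of the measure $\mathrm{PH}_\alpha(\tilde{\boldsymbol\pi},\tilde{\mathbf T})$, which is absolutely continuous with respect to Lebesgue measure, and an atom at zero of size $1-\tilde{\boldsymbol\pi}\mathbf e$. -/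

import Mathlib

open MeasureTheory ProbabilityTheory
open scoped ENNReal Matrix

noncomputable section

/-- The Mittag-Leffler function `E_{a,b}(z) = ∑ z ^ k / Γ (a k + b)` on the real line. -/
def mittagLeffler (a b z : ℝ) : ℝ :=
  ∑' k : ℕ, z ^ k / Real.Gamma (a * k + b)

/-- The Mittag-Leffler distribution `ML(a, l)`, with density
`l * x ^ (a - 1) * E_{a,a} (- l * x ^ a)` on `(0, ∞)`. -/
def mlMeasure (a l : ℝ) : Measure ℝ :=
  (volume.restrict (Set.Ioi 0)).withDensity fun x =>
    ENNReal.ofReal (l * x ^ (a - 1) * mittagLeffler a a (-l * x ^ a))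

section PhaseType

variable {ι : Type*} [Fintype ι] [DecidableEq ι]

/-- The exit rate vector `t = - T e`. -/
def exitRates (T : Matrix ι ι ℝ) : ι → ℝ := -(T *ᵥ 1)

/-- The transition matrix `Q` of the embedded jump chain. The state space is `Option ι`: the states
`some i` are the phases and `none` is the absorbing state. The holding parameter of the phase `i` is
`λ_i = - T i i`; one has `q_ii = 0` and `q_ij = t_ij / λ_i`, `q_{i,none} = t_i / λ_i`. -/
def jumpMatrix (T : Matrix ι ι ℝ) : Matrix (Option ι) (Option ι) ℝ
  | some i, some j => if i = j then 0 else T i j / (-T i i)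
  | some i, none => exitRates T i / (-T i i)
  | none, some _ => 0
  | none, none => 1

/-- `T` is the sub-intensity matrix of a process with transient phases and one absorbing state.
The state space is finite and absorption is the only absorbing class, so the phases are all
transient exactly when absorption can be reached from each of them. -/
structure IsTransientSubIntensity (T : Matrix ι ι ℝ) : Prop where
  diag_neg : ∀ i, T i i < 0
  offDiag_nonneg : ∀ i j, i ≠ j → 0 ≤ T i j
  exit_nonneg : ∀ i, 0 ≤ exitRates T i
  transient : ∀ i, ∃ n : ℕ, 0 < (jumpMatrix T ^ n) (some i) none

/-- `μ` is the fractional phase-type distribution `PH_a(π, T)`: it is the finite measure on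
`[0, ∞)` with Laplace transform `π (u ^ a I - T)⁻¹ t` for `u ≥ 0`, where `t = - T e`.
The initial vector `π` may be defective (`π e ≤ 1`), and then `μ` has total mass `π e`, which
is the value of the transform at `u = 0`. -/
structure IsFracPhaseType (a : ℝ) (π : ι → ℝ) (T : Matrix ι ι ℝ) (μ : Measure ℝ) : Prop where
  init_nonneg : ∀ i, 0 ≤ π i
  init_sum_le : ∑ i, π i ≤ 1
  subIntensity : IsTransientSubIntensity T
  isUnit : ∀ u : ℝ, 0 ≤ u → IsUnit ((u ^ a) • (1 : Matrix ι ι ℝ) - T)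
  finite : IsFiniteMeasure μ
  nonneg : μ (Set.Iio 0) = 0
  laplace : ∀ u : ℝ, 0 ≤ u →
    ∫ x, Real.exp (-u * x) ∂μ
      = π ⬝ᵥ (((u ^ a) • (1 : Matrix ι ι ℝ) - T)⁻¹ *ᵥ exitRates T)

end PhaseType

section SemiMarkov

variable {ι Ω : Type*}

/-- The state space `Option ι` of the jump chain carries the discrete σ-algebra. -/
instance instMeasurableSpaceOptionState : MeasurableSpace (Option ι) := ⊤

/-- The data of the Markov renewal construction: `J` is the Markov chain with initial distribution
`π` on the phases and transition matrix `Q`, and `H i n` are independent `ML(a, λ_i)` variables,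
independent of the chain; `H i n` is the holding time used if the `n`-th visited state
(counted from `0`) is the phase `i`. -/
structure IsMLMarkovRenewal [Fintype ι] [DecidableEq ι] [MeasurableSpace Ω] (P : Measure Ω)
    (a : ℝ) (π : ι → ℝ) (T : Matrix ι ι ℝ)
    (J : ℕ → Ω → Option ι) (H : ι → ℕ → Ω → ℝ) : Prop where
  measurable_chain : ∀ n, Measurable (J n)
  measurable_hold : ∀ i n, Measurable (H i n)
  chain_law : ∀ (n : ℕ) (x : ℕ → Option ι),
    P {ω | ∀ k ≤ n, J k ω = x k} =
      ENNReal.ofReal ((x 0).elim 0 π * ∏ k ∈ Finset.range n, jumpMatrix T (x k) (x (k + 1)))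
  hold_law : ∀ i n, P.map (H i n) = mlMeasure a (-T i i)
  indep_hold : iIndepFun (fun (q : ι × ℕ) (ω : Ω) => H q.1 q.2 ω) P
  indep_chain_hold :
    IndepFun (fun (ω : Ω) (n : ℕ) => J n ω) (fun (ω : Ω) (q : ι × ℕ) => H q.1 q.2 ω) P

/-- The time spent in the `n`-th visited state; it is infinite in the absorbing state. -/
def sojourn (J : ℕ → Ω → Option ι) (H : ι → ℕ → Ω → ℝ) (n : ℕ) (ω : Ω) : ℝ≥0∞ :=
  (J n ω).elim ⊤ fun i => ENNReal.ofReal (H i n ω)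

/-- The time `S_n` of the `n`-th jump, with `S_0 = 0`. -/
def jumpTime (J : ℕ → Ω → Option ι) (H : ι → ℕ → Ω → ℝ) (n : ℕ) (ω : Ω) : ℝ≥0∞ :=
  ∑ k ∈ Finset.range n, sojourn J H k ω

open Classical in
/-- The semi-Markov process: `X_t = J n` for `S_n ≤ t < S_{n+1}`. (Such an `n` is unique. If
there is none, that is if infinitely many jumps occur before `t`, which is a null event, the state
is put to `none`.) -/
def semiMarkov (J : ℕ → Ω → Option ι) (H : ι → ℕ → Ω → ℝ) (t : ℝ) (ω : Ω) : Option ι :=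
  if h : ∃ n : ℕ, jumpTime J H n ω ≤ ENNReal.ofReal t ∧ ENNReal.ofReal t < jumpTime J H (n + 1) ω
  then J (Nat.find h) ω
  else none

/-- The absorption time `τ = inf {t ≥ 0 | X_t is the absorbing state}` (`∞` if there is no such
`t`). -/
def absorptionTime (X : ℝ → Ω → Option ι) (ω : Ω) : ℝ≥0∞ :=
  ⨅ (t : ℝ) (_ : 0 ≤ t) (_ : X t ω = none), ENNReal.ofReal t

open Classical in
/-- The total reward `∫_0^τ ∑ i, r i * 1{X_t = i} dt` for nonnegative reward rates `r`. -/
def totalReward [Fintype ι] (r : ι → ℝ) (X : ℝ → Ω → Option ι) (ω : Ω) : ℝ≥0∞ :=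
  ∫⁻ t in {t : ℝ | 0 ≤ t ∧ ENNReal.ofReal t < absorptionTime X ω},
    ∑ i, if X t ω = some i then ENNReal.ofReal (r i) else 0

end SemiMarkov

section Reward

variable {ι : Type*} [Fintype ι] [DecidableEq ι]

/-- `E_+` consists of the phases with positive reward. -/
abbrev PosPhase (r : ι → ℝ) : Type _ := {i : ι // 0 < r i}

/-- `E_0` consists of the phases with reward zero. -/
abbrev ZeroPhase (r : ι → ℝ) : Type _ := {i : ι // r i = 0}

/-- The block `T_{++}` of `T`. -/
def blockPP (r : ι → ℝ) (T : Matrix ι ι ℝ) : Matrix (PosPhase r) (PosPhase r) ℝ :=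
  T.submatrix Subtype.val Subtype.val

/-- The block `T_{+0}` of `T`. -/
def blockPZ (r : ι → ℝ) (T : Matrix ι ι ℝ) : Matrix (PosPhase r) (ZeroPhase r) ℝ :=
  T.submatrix Subtype.val Subtype.val

/-- The block `T_{0+}` of `T`. -/
def blockZP (r : ι → ℝ) (T : Matrix ι ι ℝ) : Matrix (ZeroPhase r) (PosPhase r) ℝ :=
  T.submatrix Subtype.val Subtype.val

/-- The block `T_{00}` of `T`. -/
def blockZZ (r : ι → ℝ) (T : Matrix ι ι ℝ) : Matrix (ZeroPhase r) (ZeroPhase r) ℝ :=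
  T.submatrix Subtype.val Subtype.val

/-- `π̃ = π_+ + π_0 (-T_{00})⁻¹ T_{0+}`. -/
def rewardInit (π : ι → ℝ) (T : Matrix ι ι ℝ) (r : ι → ℝ) : PosPhase r → ℝ :=
  (fun i : PosPhase r => π i) + (fun i : ZeroPhase r => π i) ᵥ* ((-blockZZ r T)⁻¹ * blockZP r T)

/-- `T̃ = Δ(r_+ ^ a)⁻¹ (T_{++} + T_{+0} (-T_{00})⁻¹ T_{0+})`. -/
def rewardSubIntensity (a : ℝ) (T : Matrix ι ι ℝ) (r : ι → ℝ) :
    Matrix (PosPhase r) (PosPhase r) ℝ :=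
  (Matrix.diagonal fun i : PosPhase r => r i ^ a)⁻¹ *
    (blockPP r T + blockPZ r T * (-blockZZ r T)⁻¹ * blockZP r T)

end Reward

end

/-! The Laplace transform of $Y$ is computed by first-step analysis, and zero-reward phases are then
removed by linear algebra. Absorption is almost surely reached after finitely many jumps, so $Y$ is
the finite sum of the $r_{J_k}H_k$ over the visited phases (`totalReward_eq`), and $e^{-uY}$ is a
product of one factor per visit. Given the path the holding times are independent, so each visit to
$i$ contributes $g_i=\lambda_i/(\lambda_i+(ur_i)^\alpha)$, the Laplace transform of $r_iH^i$ at $u$.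
Summing over paths gives powers of the jump matrix with row $i$ multiplied by $g_i$: a chain killed
at $i$ with probability $1-g_i$. Its absorption probabilities $v$ satisfy the first-step equation,
which for this $g$ reads $(ur_i)^\alpha v_i-(\mathbf Tv)_i=t_i$ (`exists_lintegral_eq`).

On $E_0$ this equation does not involve $u$ and expresses $v_0$ through $v_+$. Substituting it
produces the Schur complement of $\mathbf T_{00}$; division of row $i$ by $r_i^\alpha$ gives
$(u^\alpha\mathbf I-\tilde{\mathbf T})v_+=\tilde{\mathbf t}$ and $\boldsymbol\pi
v=\tilde{\boldsymbol\pi}v_++(1-\tilde{\boldsymbol\pi}\mathbf e)$. The same scheme with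
$g_i=1\{r_i=0\}$ in place of the transforms gives the atom at zero. Off zero the law has no singular
part, since a sum of independent variables with one absolutely continuous summand is absolutely
continuous.

Invertibility, sign and transience claims all come from a minimum principle equivalent, given the
sign conditions, to transience and inherited by $\mathbf T_{00}$, by the Schur complement and by
positive row scaling.

The analytic difficulty is the transform of the Mittag-Leffler law. Termwise integration works only
for $u^\alpha>\lambda$, and `mlMeasure` truncates its density at zero, so the density must first be
shown nonnegative. This follows from the complete monotonicity of $\lambda/(\lambda+u^\alpha)$,
whose alternating differences are Hausdorff moments of a weighted density (`mlDensity_ae_nonneg`).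
Analytic continuation then reaches all $u>0$. -/

noncomputable section

/-! ### Sub-intensity matrices and the minimum principle -/

section MinimumPrinciple

variable {ι : Type*} [Fintype ι] [DecidableEq ι]

/-- The minimum principle: a vector on whose negative entries `S w` is nonpositive is
nonnegative. -/
def MinimumPrinciple (S : Matrix ι ι ℝ) : Prop :=
  ∀ w : ι → ℝ, (∀ i, w i < 0 → (S *ᵥ w) i ≤ 0) → ∀ i, 0 ≤ w i

omit [DecidableEq ι] in
lemma exitRates_apply (T : Matrix ι ι ℝ) (i : ι) : exitRates T i = -∑ j, T i j := by
  simp [exitRates, Matrix.mulVec, dotProduct]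

lemma jumpMatrix_nonneg {T : Matrix ι ι ℝ} (hd : ∀ i, T i i < 0)
    (ho : ∀ i j, i ≠ j → 0 ≤ T i j) (he : ∀ i, 0 ≤ exitRates T i) (x y : Option ι) :
    0 ≤ jumpMatrix T x y := by
  rcases x with _ | i <;> rcases y with _ | j <;> simp only [jumpMatrix]
  · exact zero_le_one
  · exact le_rfl
  · exact div_nonneg (he i) (neg_nonneg.2 (hd i).le)
  · split_ifs with h
    · exact le_rfl
    · exact div_nonneg (ho i j h) (neg_nonneg.2 (hd i).le)

lemma pow_jumpMatrix_nonneg {T : Matrix ι ι ℝ} (hd : ∀ i, T i i < 0)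
    (ho : ∀ i j, i ≠ j → 0 ≤ T i j) (he : ∀ i, 0 ≤ exitRates T i) (n : ℕ) (x y : Option ι) :
    0 ≤ (jumpMatrix T ^ n) x y := by
  induction n generalizing x with
  | zero => rw [pow_zero, Matrix.one_apply]; split_ifs <;> norm_num
  | succ n ih =>
    rw [pow_succ', Matrix.mul_apply]
    exact Finset.sum_nonneg fun z _ => mul_nonneg (jumpMatrix_nonneg hd ho he x z) (ih z)

/-- At a phase where $w$ attains a negative minimum $m$, $(Tw)_i=\sum_j t_{ij}(w_j-m)-m\,t_i$ is a
sum of nonnegative terms, so all vanish: there is no exit and every jump leads to another minimiser.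
Absorption is then unreachable from the minimisers. -/
lemma IsTransientSubIntensity.minimumPrinciple {T : Matrix ι ι ℝ}
    (hT : IsTransientSubIntensity T) : MinimumPrinciple T := by
  intro w hw
  by_contra! hneg
  obtain ⟨k, hk⟩ := hneg
  have : Nonempty ι := ⟨k⟩
  obtain ⟨i₀, hi₀⟩ := Finite.exists_min w
  set m := w i₀ with hm
  have hm0 : m < 0 := (hi₀ k).trans_lt hk
  have key : ∀ i, w i = m → exitRates T i = 0 ∧ ∀ j, T i j * (w j - m) = 0 := by
    intro i hi
    have h1 : (T *ᵥ w) i = ∑ j, T i j * (w j - m) + (-m) * exitRates T i := by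
      rw [exitRates_apply]
      simp only [Matrix.mulVec, dotProduct, mul_sub, Finset.sum_sub_distrib, ← Finset.sum_mul]
      ring
    have h2 : ∀ j ∈ Finset.univ, 0 ≤ T i j * (w j - m) := by
      intro j _
      by_cases hij : i = j
      · subst hij; simp [hi]
      · exact mul_nonneg (hT.offDiag_nonneg i j hij) (sub_nonneg.2 (hi₀ j))
    have h3 := hw i (hi ▸ hm0)
    have h4 : 0 ≤ (-m) * exitRates T i := mul_nonneg (by linarith) (hT.exit_nonneg i)
    have h5 := Finset.sum_nonneg h2
    refine ⟨?_, fun j => (Finset.sum_eq_zero_iff_of_nonneg h2).1 (by linarith) j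
      (Finset.mem_univ j)⟩
    have : (-m) * exitRates T i = 0 := by linarith
    exact (mul_eq_zero.1 this).resolve_left (by linarith)
  have hzero : ∀ n i, w i = m → (jumpMatrix T ^ n) (some i) none = 0 := by
    intro n
    induction n with
    | zero => intro i _; simp
    | succ n ih =>
      intro i hi
      obtain ⟨he, hj⟩ := key i hi
      rw [pow_succ', Matrix.mul_apply, Fintype.sum_option]
      have h0 : jumpMatrix T (some i) none = 0 := by simp [jumpMatrix, he]
      rw [h0, zero_mul, zero_add]
      refine Finset.sum_eq_zero fun j _ => ?_
      rcases mul_eq_zero.1 (hj j) with h | h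
      · simp [jumpMatrix, h]
      · rw [ih j (by linarith), mul_zero]
  obtain ⟨n, hn⟩ := hT.transient i₀
  exact hn.ne' (hzero n i₀ rfl)

/-- The phases from which absorption is unreachable form a closed set $M$ without exit, so $-1_M$
violates the minimum principle unless $M$ is empty. The vector $-1_{\{i\}}$ gives the sign of the
diagonal entry. -/
lemma MinimumPrinciple.isTransientSubIntensity {T : Matrix ι ι ℝ} (hT : MinimumPrinciple T)
    (ho : ∀ i j, i ≠ j → 0 ≤ T i j) (he : ∀ i, 0 ≤ exitRates T i) :
    IsTransientSubIntensity T := by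
  have hd : ∀ i, T i i < 0 := by
    intro i
    by_contra! h
    have := hT (fun j => if j = i then -1 else 0) (fun j hj => ?_) i
    · simp at this
      linarith
    · have hji : j = i := by
        by_contra hne
        simp [hne] at hj
      subst hji
      simp [Matrix.mulVec, dotProduct, h]
  refine ⟨hd, ho, he, ?_⟩
  by_contra! hneg
  obtain ⟨i₀, hi₀⟩ := hneg
  classical
  let M : ι → Prop := fun i => ∀ n, (jumpMatrix T ^ n) (some i) none ≤ 0
  have hM : ∀ i, M i → exitRates T i = 0 ∧ ∀ j, ¬ M j → T i j = 0 := by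
    intro i hi
    have hle : ∀ n (y : Option ι),
        jumpMatrix T (some i) y * (jumpMatrix T ^ n) y none ≤ 0 := by
      intro n y
      refine le_trans ?_ (hi (n + 1))
      rw [pow_succ', Matrix.mul_apply]
      exact Finset.single_le_sum (f := fun z => jumpMatrix T (some i) z * (jumpMatrix T ^ n) z none)
        (fun z _ => mul_nonneg (jumpMatrix_nonneg hd ho he _ _)
          (pow_jumpMatrix_nonneg hd ho he _ _ _)) (Finset.mem_univ y)
    have hpos : 0 < -T i i := neg_pos.2 (hd i)
    constructor
    · have h1 := hle 0 none
      simp only [pow_zero, Matrix.one_apply_eq, mul_one, jumpMatrix] at h1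
      have h2 : exitRates T i ≤ 0 := by
        by_contra! h
        exact absurd (div_pos h hpos) (not_lt.2 h1)
      exact le_antisymm h2 (he i)
    · intro j hj
      have hij : i ≠ j := fun h => hj (h ▸ hi)
      simp only [M, not_forall, not_le] at hj
      obtain ⟨n, hn⟩ := hj
      have h1 := hle n (some j)
      simp only [jumpMatrix, if_neg hij] at h1
      by_contra hne
      have h2 : 0 < T i j := lt_of_le_of_ne (ho i j hij) (Ne.symm hne)
      exact absurd (mul_pos (div_pos h2 hpos) hn) (not_lt.2 h1)
  have := hT (fun i => if M i then -1 else 0) (fun i hi => ?_) i₀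
  · have h0 : M i₀ := hi₀
    simp only [if_pos h0] at this
    linarith
  · have hMi : M i := by
      by_contra h
      simp [h] at hi
    obtain ⟨h1, h2⟩ := hM i hMi
    rw [exitRates_apply] at h1
    have : (T *ᵥ fun i => if M i then (-1 : ℝ) else 0) i = -∑ j, T i j := by
      rw [← Finset.sum_neg_distrib]
      refine Finset.sum_congr rfl fun j _ => ?_
      by_cases hj : M j
      · simp [hj]
      · simp [hj, h2 j hj]
    rw [this, h1]

/-- A kernel vector has $(Tw)_i=d_iw_i\le 0$ wherever $w_i<0$, hence $w\ge 0$; the same holds for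
$-w$. -/
lemma MinimumPrinciple.isUnit_diagonal_sub {T : Matrix ι ι ℝ} (hT : MinimumPrinciple T)
    (d : ι → ℝ) (hd : ∀ i, 0 ≤ d i) : IsUnit (Matrix.diagonal d - T) := by
  rw [← Matrix.mulVec_injective_iff_isUnit]
  have key : ∀ w : ι → ℝ, (Matrix.diagonal d - T) *ᵥ w = 0 → ∀ i, 0 ≤ w i := by
    intro w hw
    refine hT w fun i hi => ?_
    have := congrFun hw i
    rw [Matrix.sub_mulVec, Pi.sub_apply, Matrix.mulVec_diagonal, Pi.zero_apply] at this
    nlinarith [hd i]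
  rw [← Matrix.coe_mulVecLin, injective_iff_map_eq_zero]
  intro w hw
  rw [Matrix.mulVecLin_apply] at hw
  ext i
  have h1 := key w hw i
  have h2 := key (-w) (by rw [Matrix.mulVec_neg, hw, neg_zero]) i
  simp only [Pi.neg_apply, Pi.zero_apply] at h2 ⊢
  linarith

lemma MinimumPrinciple.isUnit_neg {T : Matrix ι ι ℝ} (hT : MinimumPrinciple T) :
    IsUnit (-T) := by
  have := hT.isUnit_diagonal_sub 0 (fun _ => le_rfl)
  simpa using this

lemma MinimumPrinciple.isUnit_smul_one_sub {T : Matrix ι ι ℝ} (hT : MinimumPrinciple T)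
    {c : ℝ} (hc : 0 ≤ c) : IsUnit (c • (1 : Matrix ι ι ℝ) - T) := by
  have := hT.isUnit_diagonal_sub (fun _ => c) (fun _ => hc)
  rwa [← Matrix.smul_one_eq_diagonal] at this

lemma MinimumPrinciple.inv_mulVec_nonneg {T : Matrix ι ι ℝ} (hT : MinimumPrinciple T)
    {b : ι → ℝ} (hb : ∀ i, 0 ≤ b i) (i : ι) : 0 ≤ ((-T)⁻¹ *ᵥ b) i := by
  refine hT _ (fun j _ => ?_) i
  have h : (-T) *ᵥ ((-T)⁻¹ *ᵥ b) = b := by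
    rw [Matrix.mulVec_mulVec, Matrix.mul_nonsing_inv _
      ((Matrix.isUnit_iff_isUnit_det _).1 hT.isUnit_neg), Matrix.one_mulVec]
  have h' := congrFun h j
  rw [Matrix.neg_mulVec, Pi.neg_apply] at h'
  linarith [hb j]

lemma MinimumPrinciple.inv_mul_nonneg {κ : Type*} {T : Matrix ι ι ℝ} (hT : MinimumPrinciple T)
    {B : Matrix ι κ ℝ} (hB : ∀ i j, 0 ≤ B i j) (i : ι) (j : κ) : 0 ≤ ((-T)⁻¹ * B) i j :=
  hT.inv_mulVec_nonneg (b := fun k => B k j) (fun k => hB k j) i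

end MinimumPrinciple

/-! ### Elimination of the zero-reward phases -/

section Blocks

variable {ι : Type*} [Fintype ι] [DecidableEq ι]

omit [DecidableEq ι] in
lemma sum_eq_sum_posPhase_add_sum_zeroPhase {r : ι → ℝ} (hr0 : ∀ i, 0 ≤ r i) (f : ι → ℝ) :
    ∑ i, f i = ∑ i : PosPhase r, f i + ∑ i : ZeroPhase r, f i := by
  rw [← Fintype.sum_subtype_add_sum_subtype (fun i => 0 < r i) f]
  congr 1
  refine Fintype.sum_equiv (Equiv.subtypeEquivRight fun i => ?_) _ _ fun i => rfl
  rw [not_lt]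
  exact ⟨fun h => le_antisymm h (hr0 i), fun h => h.le⟩

omit [DecidableEq ι] in
lemma mulVec_posPhase {r : ι → ℝ} (hr0 : ∀ i, 0 ≤ r i) (T : Matrix ι ι ℝ) (w : ι → ℝ)
    (i : PosPhase r) :
    (T *ᵥ w) i = (blockPP r T *ᵥ fun j => w j) i + (blockPZ r T *ᵥ fun j => w j) i := by
  simp only [Matrix.mulVec, dotProduct]
  rw [sum_eq_sum_posPhase_add_sum_zeroPhase hr0]
  rfl

omit [DecidableEq ι] in
lemma mulVec_zeroPhase {r : ι → ℝ} (hr0 : ∀ i, 0 ≤ r i) (T : Matrix ι ι ℝ) (w : ι → ℝ)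
    (i : ZeroPhase r) :
    (T *ᵥ w) i = (blockZP r T *ᵥ fun j => w j) i + (blockZZ r T *ᵥ fun j => w j) i := by
  simp only [Matrix.mulVec, dotProduct]
  rw [sum_eq_sum_posPhase_add_sum_zeroPhase hr0]
  rfl

/-- The vector with the given blocks on `E_+` and `E_0`. -/
def joinPhases (r : ι → ℝ) (v : PosPhase r → ℝ) (w : ZeroPhase r → ℝ) (i : ι) : ℝ :=
  -- The last branch is a default value, never reached for nonnegative rewards.
  if h : 0 < r i then v ⟨i, h⟩ else if h' : r i = 0 then w ⟨i, h'⟩ else 0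

omit [Fintype ι] [DecidableEq ι] in
@[simp] lemma joinPhases_pos {r : ι → ℝ} (v : PosPhase r → ℝ) (w : ZeroPhase r → ℝ)
    (i : PosPhase r) : joinPhases r v w i = v i := by
  simp [joinPhases, i.2]

omit [Fintype ι] [DecidableEq ι] in
@[simp] lemma joinPhases_zero {r : ι → ℝ} (v : PosPhase r → ℝ) (w : ZeroPhase r → ℝ)
    (i : ZeroPhase r) : joinPhases r v w i = w i := by
  simp [joinPhases, i.2]

/-- The Schur complement of the block `T_{00}`. -/
def schurComplement (r : ι → ℝ) (T : Matrix ι ι ℝ) : Matrix (PosPhase r) (PosPhase r) ℝ :=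
  blockPP r T + blockPZ r T * (-blockZZ r T)⁻¹ * blockZP r T

variable {r : ι → ℝ} {T : Matrix ι ι ℝ}

/-- Extension by zero to $E_+$ creates no new negative entries and leaves the image on $E_0$
unchanged. -/
lemma MinimumPrinciple.blockZZ (hr0 : ∀ i, 0 ≤ r i) (hT : MinimumPrinciple T) :
    MinimumPrinciple (blockZZ r T) := by
  intro w hw i
  have := hT (joinPhases r 0 w) (fun j hj => ?_) i
  · simpa using this
  · rcases (hr0 j).lt_or_eq with h | h
    · have := joinPhases_pos (r := r) 0 w ⟨j, h⟩
      simp only [Pi.zero_apply] at this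
      exact absurd hj (by rw [this]; exact lt_irrefl 0)
    · have h1 := mulVec_zeroPhase hr0 T (joinPhases r 0 w) ⟨j, h.symm⟩
      have h2 := joinPhases_zero (r := r) 0 w ⟨j, h.symm⟩
      simp only [joinPhases_pos, joinPhases_zero] at h1
      simp only at h2
      rw [h1]
      have h3 := hw ⟨j, h.symm⟩ (by rw [← h2]; exact hj)
      have h4 : (fun j : PosPhase r => (0 : PosPhase r → ℝ) j) = 0 := rfl
      rw [h4, Matrix.mulVec_zero]
      simpa using h3

lemma isUnit_det_neg_blockZZ (hr0 : ∀ i, 0 ≤ r i) (hT : MinimumPrinciple T) :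
    IsUnit (-_root_.blockZZ r T).det :=
  (Matrix.isUnit_iff_isUnit_det _).1 (hT.blockZZ hr0).isUnit_neg

/-- Extend $v$ to $E_0$ harmonically, by $w=(-T_{00})^{-1}T_{0+}v$. Then $T(v,w)$ vanishes on $E_0$
and equals the Schur complement applied to $v$ on $E_+$. -/
lemma MinimumPrinciple.schurComplement (hr0 : ∀ i, 0 ≤ r i) (hT : MinimumPrinciple T) :
    MinimumPrinciple (schurComplement r T) := by
  intro v hv i
  set w : ZeroPhase r → ℝ := (-_root_.blockZZ r T)⁻¹ *ᵥ (blockZP r T *ᵥ v) with hw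
  have hw' : _root_.blockZZ r T *ᵥ w = -(blockZP r T *ᵥ v) := by
    have : (-_root_.blockZZ r T) *ᵥ w = blockZP r T *ᵥ v := by
      rw [hw, Matrix.mulVec_mulVec, Matrix.mul_nonsing_inv _ (isUnit_det_neg_blockZZ hr0 hT),
        Matrix.one_mulVec]
    rw [← this, Matrix.neg_mulVec, neg_neg]
  have := hT (joinPhases r v w) (fun j hj => ?_) i
  · simpa using this
  · rcases (hr0 j).lt_or_eq with h | h
    · have h1 := mulVec_posPhase hr0 T (joinPhases r v w) ⟨j, h⟩
      have h2 := joinPhases_pos (r := r) v w ⟨j, h⟩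
      simp only [joinPhases_pos, joinPhases_zero] at h1
      simp only at h2
      have h3 := hv ⟨j, h⟩ (by rw [← h2]; exact hj)
      rw [h1]
      have h4 : (_root_.schurComplement r T *ᵥ v) ⟨j, h⟩ =
          (blockPP r T *ᵥ v) ⟨j, h⟩ + (blockPZ r T *ᵥ w) ⟨j, h⟩ := by
        rw [_root_.schurComplement, Matrix.add_mulVec, hw, Matrix.mul_assoc,
          ← Matrix.mulVec_mulVec, ← Matrix.mulVec_mulVec]
        rfl
      rw [h4] at h3
      exact h3
    · have h1 := mulVec_zeroPhase hr0 T (joinPhases r v w) ⟨j, h.symm⟩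
      simp only [joinPhases_pos, joinPhases_zero] at h1
      rw [h1]
      change (blockZP r T *ᵥ v) ⟨j, h.symm⟩ + (_root_.blockZZ r T *ᵥ w) ⟨j, h.symm⟩ ≤ 0
      rw [hw', Pi.neg_apply, add_neg_cancel]

lemma rewardSubIntensity_mulVec (a : ℝ) (v : PosPhase r → ℝ)
    (i : PosPhase r) :
    (rewardSubIntensity a T r *ᵥ v) i = (r i ^ a)⁻¹ * (schurComplement r T *ᵥ v) i := by
  have hinv : (Matrix.diagonal fun i : PosPhase r => r i ^ a)⁻¹
      = Matrix.diagonal fun i : PosPhase r => (r i ^ a)⁻¹ := by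
    refine Matrix.inv_eq_right_inv ?_
    rw [Matrix.diagonal_mul_diagonal, ← Matrix.diagonal_one]
    congr 1
    ext i
    exact mul_inv_cancel₀ (Real.rpow_pos_of_pos i.2 a).ne'
  rw [rewardSubIntensity, hinv, ← Matrix.mulVec_mulVec, Matrix.mulVec_diagonal]
  rfl

lemma MinimumPrinciple.rewardSubIntensity (hr0 : ∀ i, 0 ≤ r i) (hT : MinimumPrinciple T) (a : ℝ) :
    MinimumPrinciple (rewardSubIntensity a T r) := by
  intro v hv
  refine hT.schurComplement hr0 v fun i hi => ?_
  have := hv i hi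
  rw [rewardSubIntensity_mulVec] at this
  have hpos : 0 < (r i ^ a)⁻¹ := inv_pos.2 (Real.rpow_pos_of_pos i.2 a)
  by_contra! h
  exact absurd (mul_pos hpos h) (not_lt.2 this)

/-- The probability to be absorbed from `E_0` without visiting `E_+`. -/
def zeroPhaseExit (r : ι → ℝ) (T : Matrix ι ι ℝ) : ZeroPhase r → ℝ :=
  (-blockZZ r T)⁻¹ *ᵥ fun i => exitRates T i

/-- From $E_0$ the chain either enters $E_+$ or is absorbed first, and these probabilities add up to
one. Algebraically, this is the row-sum identity on $E_0$ multiplied by $(-T_{00})^{-1}$. -/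
lemma inv_blockZZ_mulVec_blockZP_one (hr0 : ∀ i, 0 ≤ r i) (hT : MinimumPrinciple T) :
    (-blockZZ r T)⁻¹ *ᵥ (blockZP r T *ᵥ 1) = 1 - zeroPhaseExit r T := by
  have h1 : blockZP r T *ᵥ 1 = (-blockZZ r T) *ᵥ 1 - fun i : ZeroPhase r => exitRates T i := by
    ext i
    have := mulVec_zeroPhase hr0 T 1 i
    have he : exitRates T i = -(T *ᵥ 1) i := rfl
    rw [Pi.sub_apply, he, this, Matrix.neg_mulVec]
    simp only [Pi.neg_apply]
    change _ = -(blockZZ r T *ᵥ 1) i - -((blockZP r T *ᵥ 1) i + (blockZZ r T *ᵥ 1) i)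
    ring
  rw [h1, Matrix.mulVec_sub, Matrix.mulVec_mulVec,
    Matrix.nonsing_inv_mul _ (isUnit_det_neg_blockZZ hr0 hT), Matrix.one_mulVec]
  rfl

lemma schurComplement_mulVec (v : PosPhase r → ℝ) :
    schurComplement r T *ᵥ v = blockPP r T *ᵥ v +
      blockPZ r T *ᵥ ((-blockZZ r T)⁻¹ *ᵥ (blockZP r T *ᵥ v)) := by
  rw [schurComplement, Matrix.add_mulVec, Matrix.mul_assoc, ← Matrix.mulVec_mulVec,
    ← Matrix.mulVec_mulVec]

lemma schurComplement_mulVec_one (hr0 : ∀ i, 0 ≤ r i) (hT : MinimumPrinciple T)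
    (i : PosPhase r) :
    (schurComplement r T *ᵥ 1) i = -(exitRates T i + (blockPZ r T *ᵥ zeroPhaseExit r T) i) := by
  rw [schurComplement_mulVec, inv_blockZZ_mulVec_blockZP_one hr0 hT, Matrix.mulVec_sub]
  have h1 := mulVec_posPhase hr0 T 1 i
  have he : exitRates T i = -(T *ᵥ 1) i := rfl
  rw [he, h1]
  simp only [Pi.add_apply, Pi.sub_apply]
  change _ = -(-((blockPP r T *ᵥ 1) i + (blockPZ r T *ᵥ 1) i) + _)
  ring

/-- Exit happens directly or through an excursion into $E_0$ that does not return; this form makes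
the sign evident. -/
lemma exitRates_rewardSubIntensity (hr0 : ∀ i, 0 ≤ r i) (hT : MinimumPrinciple T) (a : ℝ)
    (i : PosPhase r) :
    exitRates (rewardSubIntensity a T r) i =
      (r i ^ a)⁻¹ * (exitRates T i + (blockPZ r T *ᵥ zeroPhaseExit r T) i) := by
  rw [exitRates, Pi.neg_apply, rewardSubIntensity_mulVec, schurComplement_mulVec_one hr0 hT]
  ring

lemma zeroPhaseExit_nonneg (hr0 : ∀ i, 0 ≤ r i) (hT : IsTransientSubIntensity T)
    (i : ZeroPhase r) : 0 ≤ zeroPhaseExit r T i :=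
  (hT.minimumPrinciple.blockZZ hr0).inv_mulVec_nonneg (fun j => hT.exit_nonneg j) i

lemma inv_blockZZ_mul_blockZP_nonneg (hr0 : ∀ i, 0 ≤ r i) (hT : IsTransientSubIntensity T)
    (i : ZeroPhase r) (j : PosPhase r) : 0 ≤ ((-blockZZ r T)⁻¹ * blockZP r T) i j := by
  refine (hT.minimumPrinciple.blockZZ hr0).inv_mul_nonneg (fun k l => ?_) i j
  refine hT.offDiag_nonneg _ _ fun h => ?_
  have h1 := k.2
  rw [h] at h1
  exact l.2.ne' h1

theorem IsTransientSubIntensity.rewardSubIntensity (hr0 : ∀ i, 0 ≤ r i)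
    (hT : IsTransientSubIntensity T) (a : ℝ) :
    IsTransientSubIntensity (rewardSubIntensity a T r) := by
  have hpz : ∀ (i : PosPhase r) (j : ZeroPhase r), 0 ≤ blockPZ r T i j := by
    intro i j
    refine hT.offDiag_nonneg _ _ fun h => ?_
    have h1 := j.2
    rw [← h] at h1
    exact i.2.ne' h1
  refine (hT.minimumPrinciple.rewardSubIntensity hr0 a).isTransientSubIntensity ?_ ?_
  · intro i j hij
    have h := rewardSubIntensity_mulVec (T := T) a (Pi.single j 1) i
    rw [Matrix.mulVec_single_one, Matrix.mulVec_single_one] at h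
    simp only [Matrix.col_apply] at h
    rw [h]
    refine mul_nonneg (inv_nonneg.2 (Real.rpow_nonneg (hr0 i) a)) ?_
    rw [schurComplement, Matrix.mul_assoc, Matrix.add_apply, Matrix.mul_apply]
    refine add_nonneg (hT.offDiag_nonneg _ _ fun h => hij (Subtype.ext h)) ?_
    exact Finset.sum_nonneg fun k _ => mul_nonneg (hpz i k)
      (inv_blockZZ_mul_blockZP_nonneg hr0 hT k j)
  · intro i
    rw [exitRates_rewardSubIntensity hr0 hT.minimumPrinciple]
    refine mul_nonneg (inv_nonneg.2 (Real.rpow_nonneg (hr0 i) a))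
      (add_nonneg (hT.exit_nonneg _) ?_)
    exact Finset.sum_nonneg fun k _ => mul_nonneg (hpz i k) (zeroPhaseExit_nonneg hr0 hT k)

lemma rewardInit_nonneg (hr0 : ∀ i, 0 ≤ r i) (hT : IsTransientSubIntensity T) {π : ι → ℝ}
    (hπ0 : ∀ i, 0 ≤ π i) (i : PosPhase r) : 0 ≤ rewardInit π T r i :=
  add_nonneg (hπ0 i) (Finset.sum_nonneg fun k _ => mul_nonneg (hπ0 k)
    (inv_blockZZ_mul_blockZP_nonneg hr0 hT k i))

lemma rewardInit_dotProduct (π : ι → ℝ) (v : PosPhase r → ℝ) :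
    rewardInit π T r ⬝ᵥ v = (fun i : PosPhase r => π i) ⬝ᵥ v +
      (fun i : ZeroPhase r => π i) ⬝ᵥ ((-blockZZ r T)⁻¹ *ᵥ (blockZP r T *ᵥ v)) := by
  rw [rewardInit, add_dotProduct, ← Matrix.dotProduct_mulVec, Matrix.mulVec_mulVec]

/-- The defect of $\tilde\pi$ is the probability of starting in $E_0$ and being absorbed without
ever visiting $E_+$. -/
lemma one_sub_sum_rewardInit (hr0 : ∀ i, 0 ≤ r i) (hT : MinimumPrinciple T) {π : ι → ℝ}
    (hπ1 : ∑ i, π i = 1) :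
    1 - ∑ i, rewardInit π T r i = (fun i : ZeroPhase r => π i) ⬝ᵥ zeroPhaseExit r T := by
  have h := rewardInit_dotProduct (T := T) (r := r) π 1
  rw [inv_blockZZ_mulVec_blockZP_one hr0 hT, dotProduct_sub, dotProduct_one, dotProduct_one,
    dotProduct_one] at h
  rw [sum_eq_sum_posPhase_add_sum_zeroPhase hr0] at hπ1
  rw [h]
  linarith

/-- Elimination of the phases with reward zero. -/
lemma eq_zeroPhaseExit_add (hr0 : ∀ i, 0 ≤ r i) (hT : MinimumPrinciple T) {v : ι → ℝ}
    (hv : ∀ i, r i = 0 → -(T *ᵥ v) i = exitRates T i) :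
    (-blockZZ r T)⁻¹ *ᵥ (blockZP r T *ᵥ fun i => v i) =
      (fun i : ZeroPhase r => v i) - zeroPhaseExit r T := by
  have h1 : blockZP r T *ᵥ (fun i => v i) =
      (-blockZZ r T) *ᵥ (fun i => v i) - fun i : ZeroPhase r => exitRates T i := by
    ext i
    rw [Pi.sub_apply, ← hv i i.2, mulVec_zeroPhase hr0 T v i, Matrix.neg_mulVec, Pi.neg_apply]
    ring
  rw [h1, Matrix.mulVec_sub, Matrix.mulVec_mulVec,
    Matrix.nonsing_inv_mul _ (isUnit_det_neg_blockZZ hr0 hT), Matrix.one_mulVec]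
  rfl

/-- Only the equation on $E_0$ is assumed, so the identity serves both the Laplace transform and the
atom at zero. -/
lemma dotProduct_eq_rewardInit_dotProduct (hr0 : ∀ i, 0 ≤ r i) (hT : MinimumPrinciple T)
    {π : ι → ℝ} (hπ1 : ∑ i, π i = 1) {v : ι → ℝ}
    (hv : ∀ i, r i = 0 → -(T *ᵥ v) i = exitRates T i) :
    π ⬝ᵥ v = rewardInit π T r ⬝ᵥ (fun i => v i) + (1 - ∑ i, rewardInit π T r i) := by
  rw [one_sub_sum_rewardInit hr0 hT hπ1, rewardInit_dotProduct, eq_zeroPhaseExit_add hr0 hT hv,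
    dotProduct_sub, dotProduct, sum_eq_sum_posPhase_add_sum_zeroPhase hr0]
  simp only [dotProduct]
  ring

/-- Inserting $v_0$ into the rows of $E_+$ and dividing row $i$ by $r_i^a$ turns $(ur_i)^a$ into
$u^a$; this is why the rewards enter $\tilde T$ through their $a$-th powers. -/
lemma eq_inv_mulVec_exitRates (hr0 : ∀ i, 0 ≤ r i) (hT : MinimumPrinciple T) {a u : ℝ}
    (ha : 0 < a) (hu : 0 ≤ u) {v : ι → ℝ}
    (hv : ∀ i, (u * r i) ^ a * v i - (T *ᵥ v) i = exitRates T i) :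
    (fun i : PosPhase r => v i) =
      ((u ^ a) • (1 : Matrix (PosPhase r) (PosPhase r) ℝ) - rewardSubIntensity a T r)⁻¹ *ᵥ
        exitRates (rewardSubIntensity a T r) := by
  have hv0 : ∀ i, r i = 0 → -(T *ᵥ v) i = exitRates T i := by
    intro i hi
    rw [← hv i, hi, mul_zero, Real.zero_rpow ha.ne']
    ring
  have hunit := (hT.rewardSubIntensity hr0 a).isUnit_smul_one_sub (Real.rpow_nonneg hu a)
  have key : ((u ^ a) • (1 : Matrix (PosPhase r) (PosPhase r) ℝ) - rewardSubIntensity a T r) *ᵥ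
      (fun i : PosPhase r => v i) = exitRates (rewardSubIntensity a T r) := by
    ext i
    rw [exitRates_rewardSubIntensity hr0 hT, Matrix.sub_mulVec, Pi.sub_apply,
      rewardSubIntensity_mulVec, schurComplement_mulVec, eq_zeroPhaseExit_add hr0 hT hv0,
      Matrix.smul_mulVec, Matrix.one_mulVec, Matrix.mulVec_sub, ← hv i, mulVec_posPhase hr0 T v i,
      Real.mul_rpow hu (hr0 i)]
    have hpos := (Real.rpow_pos_of_pos i.2 a).ne'
    simp only [Pi.smul_apply, smul_eq_mul, Pi.add_apply, Pi.sub_apply]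
    field_simp
    ring
  rw [← key, Matrix.mulVec_mulVec,
    Matrix.nonsing_inv_mul _ ((Matrix.isUnit_iff_isUnit_det _).1 hunit), Matrix.one_mulVec]

end Blocks

/-! ### Complete monotonicity of the Mittag-Leffler transform, by differences -/

section CompleteMonotonicity

/-- The negative of the forward difference with step one. -/
def nabla (φ : ℝ → ℝ) (x : ℝ) : ℝ := φ x - φ (x + 1)

/-- The alternating differences of `φ` on `(0, ∞)` up to the order `n` are nonnegative. -/
def IsAlternating (n : ℕ) (φ : ℝ → ℝ) : Prop :=
  ∀ k ≤ n, ∀ x > 0, 0 ≤ nabla^[k] φ x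

lemma nabla_iterate_congr {φ ψ : ℝ → ℝ} (h : ∀ x > 0, φ x = ψ x) (n : ℕ) :
    ∀ x > 0, nabla^[n] φ x = nabla^[n] ψ x := by
  induction n with
  | zero => exact h
  | succ n ih =>
    intro x hx
    rw [Function.iterate_succ_apply', Function.iterate_succ_apply', nabla, nabla, ih x hx,
      ih (x + 1) (by linarith)]

lemma nabla_iterate_add (φ ψ : ℝ → ℝ) (n : ℕ) :
    nabla^[n] (fun x => φ x + ψ x) = fun x => nabla^[n] φ x + nabla^[n] ψ x := by
  induction n with
  | zero => rfl
  | succ n ih =>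
    ext x
    simp only [Function.iterate_succ_apply', ih, nabla]
    ring

lemma nabla_iterate_const_mul (c : ℝ) (φ : ℝ → ℝ) (n : ℕ) :
    nabla^[n] (fun x => c * φ x) = fun x => c * nabla^[n] φ x := by
  induction n with
  | zero => rfl
  | succ n ih =>
    ext x
    simp only [Function.iterate_succ_apply', ih, nabla]
    ring

lemma nabla_iterate_shift (φ : ℝ → ℝ) (n : ℕ) (x : ℝ) :
    nabla^[n] (fun x => φ (x + 1)) x = nabla^[n] φ (x + 1) := by
  induction n generalizing x with
  | zero => rfl
  | succ n ih => simp only [Function.iterate_succ_apply', ih, nabla]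

lemma IsAlternating.congr {n : ℕ} {φ ψ : ℝ → ℝ} (hφ : IsAlternating n φ)
    (h : ∀ x > 0, φ x = ψ x) : IsAlternating n ψ := fun k hk x hx => by
  rw [← nabla_iterate_congr h k x hx]
  exact hφ k hk x hx

lemma IsAlternating.mono {m n : ℕ} {φ : ℝ → ℝ} (hφ : IsAlternating n φ) (h : m ≤ n) :
    IsAlternating m φ := fun k hk => hφ k (hk.trans h)

lemma IsAlternating.nabla {n : ℕ} {φ : ℝ → ℝ} (hφ : IsAlternating (n + 1) φ) :
    IsAlternating n (nabla φ) := fun k hk x hx => by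
  rw [← Function.iterate_succ_apply]
  exact hφ (k + 1) (by omega) x hx

lemma IsAlternating.shift {n : ℕ} {φ : ℝ → ℝ} (hφ : IsAlternating n φ) :
    IsAlternating n fun x => φ (x + 1) := fun k hk x hx => by
  rw [nabla_iterate_shift]
  exact hφ k hk _ (by linarith)

lemma IsAlternating.const_mul {n : ℕ} {φ : ℝ → ℝ} (hφ : IsAlternating n φ) {c : ℝ} (hc : 0 ≤ c) :
    IsAlternating n fun x => c * φ x := fun k hk x hx => by
  rw [nabla_iterate_const_mul]
  exact mul_nonneg hc (hφ k hk x hx)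

lemma isAlternating_succ_iff {n : ℕ} {φ : ℝ → ℝ} :
    IsAlternating (n + 1) φ ↔ (∀ x > 0, 0 ≤ φ x) ∧ IsAlternating n (_root_.nabla φ) := by
  refine ⟨fun h => ⟨h 0 (Nat.zero_le _), h.nabla⟩, fun h k hk x hx => ?_⟩
  cases k with
  | zero => exact h.1 x hx
  | succ k =>
    rw [Function.iterate_succ_apply]
    exact h.2 k (by omega) x hx

lemma IsAlternating.mul {n : ℕ} {φ ψ : ℝ → ℝ} (hφ : IsAlternating n φ) (hψ : IsAlternating n ψ) :
    IsAlternating n fun x => φ x * ψ x := by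
  induction n generalizing φ ψ with
  | zero =>
    intro k hk x hx
    obtain rfl : k = 0 := by omega
    exact mul_nonneg (hφ 0 le_rfl x hx) (hψ 0 le_rfl x hx)
  | succ n ih =>
    rw [isAlternating_succ_iff]
    refine ⟨fun x hx => mul_nonneg (hφ 0 (Nat.zero_le _) x hx) (hψ 0 (Nat.zero_le _) x hx), ?_⟩
    have h1 : _root_.nabla (fun x => φ x * ψ x) =
        fun x => _root_.nabla φ x * ψ x + φ (x + 1) * _root_.nabla ψ x := by
      ext x
      simp only [_root_.nabla]
      ring
    rw [h1]
    intro k hk x hx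
    rw [nabla_iterate_add]
    exact add_nonneg (ih hφ.nabla (hψ.mono n.le_succ) k hk x hx)
      (ih (hφ.shift.mono n.le_succ) hψ.nabla k hk x hx)

/-- The reciprocal of a positive function with alternating decrements is alternating. -/
lemma isAlternating_inv {G : ℝ → ℝ} (hG : ∀ x > 0, 0 < G x)
    (hG' : ∀ n, IsAlternating n fun x => -nabla G x) (n : ℕ) :
    IsAlternating n fun x => (G x)⁻¹ := by
  induction n with
  | zero =>
    intro k hk x hx
    obtain rfl : k = 0 := by omega
    exact inv_nonneg.2 (hG x hx).le
  | succ n ih =>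
    rw [isAlternating_succ_iff]
    refine ⟨fun x hx => inv_nonneg.2 (hG x hx).le, ?_⟩
    -- $1/G(x)-1/G(x+1)=G(x)^{-1}G(x+1)^{-1}(G(x+1)-G(x))$ is a product of factors alternating to
    -- order $n$, so the order rises by one.
    refine ((ih.mul ih.shift).mul (hG' n)).congr fun x hx => ?_
    have h1 := (hG x hx).ne'
    have h2 := (hG (x + 1) (by linarith)).ne'
    simp only [nabla]
    field_simp
    ring

lemma hasDerivAt_nabla_iterate {φ φ' : ℝ → ℝ} (h : ∀ x > 0, HasDerivAt φ (φ' x) x) (n : ℕ) :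
    ∀ x > 0, HasDerivAt (nabla^[n] φ) (nabla^[n] φ' x) x := by
  induction n with
  | zero => exact h
  | succ n ih =>
    intro x hx
    simp only [Function.iterate_succ_apply']
    exact (ih x hx).sub ((ih (x + 1) (by linarith)).comp_add_const x 1)

lemma hasDerivAt_rpow_of_pos (b : ℝ) : ∀ x > 0, HasDerivAt (fun x : ℝ => x ^ b)
    (b * x ^ (b - 1)) x := fun _ hx => Real.hasDerivAt_rpow_const (Or.inl hx.ne')

lemma antitoneOn_of_hasDerivAt {φ φ' : ℝ → ℝ} (h : ∀ x > 0, HasDerivAt φ (φ' x) x)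
    (h' : ∀ x > 0, φ' x ≤ 0) {x y : ℝ} (hx : 0 < x) (hxy : x ≤ y) : φ y ≤ φ x := by
  refine antitoneOn_of_deriv_nonpos (convex_Ioi (0 : ℝ))
    (fun z hz => (h z hz).continuousAt.continuousWithinAt) ?_ ?_ hx (hx.trans_le hxy) hxy
  · rw [interior_Ioi]
    exact fun z hz => (h z hz).differentiableAt.differentiableWithinAt
  · rw [interior_Ioi]
    intro z hz
    rw [(h z hz).deriv]
    exact h' z hz

/-- Differences commute with differentiation, so the $n$-th difference of $x^b$ has derivative $b$
times that of $x^{b-1}$. This is nonpositive by induction, so the $n$-th difference decreases. -/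
lemma nabla_iterate_rpow_nonneg (n : ℕ) : ∀ b ≤ (0 : ℝ), ∀ x > 0,
    0 ≤ nabla^[n] (fun x : ℝ => x ^ b) x := by
  induction n with
  | zero => exact fun b _ x hx => Real.rpow_nonneg (le_of_lt hx) b
  | succ n ih =>
    intro b hb x hx
    rw [Function.iterate_succ_apply', nabla, sub_nonneg]
    refine antitoneOn_of_hasDerivAt (hasDerivAt_nabla_iterate (hasDerivAt_rpow_of_pos b) n)
      (fun y hy => ?_) hx (by linarith)
    rw [nabla_iterate_const_mul]
    exact mul_nonpos_of_nonpos_of_nonneg hb (ih (b - 1) (by linarith) y hy)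

/-- The $n$-th difference of $x^a$ increases, because its derivative involves the exponent $a-1\le
0$; this is where $a\le 1$ is needed. -/
lemma nabla_iterate_succ_rpow_nonpos (n : ℕ) {a : ℝ} (ha0 : 0 < a) (ha1 : a ≤ 1) {x : ℝ}
    (hx : 0 < x) : nabla^[n + 1] (fun x : ℝ => x ^ a) x ≤ 0 := by
  rw [Function.iterate_succ_apply', nabla]
  have h := antitoneOn_of_hasDerivAt (φ := fun x => -nabla^[n] (fun x : ℝ => x ^ a) x)
    (fun y hy => (hasDerivAt_nabla_iterate (hasDerivAt_rpow_of_pos a) n y hy).neg)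
    (fun y hy => ?_) hx (by linarith : x ≤ x + 1)
  · linarith
  · rw [nabla_iterate_const_mul, neg_nonpos]
    exact mul_nonneg ha0.le (nabla_iterate_rpow_nonneg n (a - 1) (by linarith) y hy)

/-- `l / (l + x ^ a)` is completely monotone, in the form of differences. -/
lemma nabla_iterate_mlTransform_nonneg (n : ℕ) {a l : ℝ} (ha0 : 0 < a) (ha1 : a ≤ 1) (hl : 0 < l)
    {x : ℝ} (hx : 0 < x) : 0 ≤ nabla^[n] (fun x : ℝ => l / (l + x ^ a)) x := by
  have h := isAlternating_inv (G := fun x => l + x ^ a)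
    (fun x hx => add_pos_of_pos_of_nonneg hl (Real.rpow_nonneg hx.le a)) (fun m k _ x hx => ?_) n
  · exact (h.const_mul hl.le).congr (fun x _ => (div_eq_mul_inv _ _).symm) n le_rfl x hx
  · have h1 : (fun x => -nabla (fun x : ℝ => l + x ^ a) x) =
        fun x => (-1) * nabla (fun x : ℝ => x ^ a) x := by
      ext x
      simp only [nabla]
      ring
    rw [h1, nabla_iterate_const_mul, ← Function.iterate_succ_apply]
    linarith [nabla_iterate_succ_rpow_nonpos k ha0 ha1 hx]

end CompleteMonotonicity

/-! ### Positivity from Hausdorff moments -/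

section MomentPositivity

open Filter Topology unitInterval

/-- A finite measure on a metric space dominates another one if it does so on nonnegative
bounded continuous functions. -/
lemma measure_le_of_forall_integral_le {X : Type*} [PseudoEMetricSpace X] [MeasurableSpace X]
    [BorelSpace X] (μ ν : Measure X) [IsFiniteMeasure μ] [IsFiniteMeasure ν]
    (h : ∀ f : C(X, ℝ), (∀ x, 0 ≤ f x) → ∫ x, f x ∂μ ≤ ∫ x, f x ∂ν) : μ ≤ ν := by
  have hclosed : ∀ F : Set X, IsClosed F → μ F ≤ ν F := by
    intro F hF
    have hpos : ∀ n : ℕ, 0 < 1 / ((n : ℝ) + 1) := fun n => Nat.one_div_pos_of_nat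
    have h1 := tendsto_integral_thickenedIndicator_of_isClosed μ hF hpos
      tendsto_one_div_add_atTop_nhds_zero_nat
    have h2 := tendsto_integral_thickenedIndicator_of_isClosed ν hF hpos
      tendsto_one_div_add_atTop_nhds_zero_nat
    have h3 : μ.real F ≤ ν.real F := le_of_tendsto_of_tendsto' h1 h2 fun n =>
      h ⟨fun x => (thickenedIndicator (hpos n) F x : ℝ),
        NNReal.continuous_coe.comp (thickenedIndicator (hpos n) F).continuous⟩
        fun x => NNReal.coe_nonneg _
    exact (ENNReal.toReal_le_toReal (measure_ne_top _ _) (measure_ne_top _ _)).1 h3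
  refine Measure.le_iff.2 fun B hB => ?_
  rw [hB.measure_eq_iSup_isClosed_of_ne_top (measure_ne_top _ _)]
  exact iSup₂_le fun F hFB => iSup_le fun hF => (hclosed F hF).trans (measure_mono hFB)

/-- Bernstein polynomials of a nonnegative function are nonnegative combinations of the monomials
$y^k(1-y)^m$ and converge uniformly. -/
lemma integral_mul_nonneg_of_bernstein {X : Type*} [MeasurableSpace X] {ρ : Measure X} {w : X → ℝ}
    (hw : Integrable w ρ) {φ : X → I} (hφ : Measurable φ)
    (h : ∀ k m : ℕ, 0 ≤ ∫ x, (φ x : ℝ) ^ k * (1 - (φ x : ℝ)) ^ m * w x ∂ρ)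
    (g : C(I, ℝ)) (hg : ∀ y, 0 ≤ g y) : 0 ≤ ∫ x, g (φ x) * w x ∂ρ := by
  have hint : ∀ f : C(I, ℝ), Integrable (fun x => f (φ x) * w x) ρ := fun f =>
    hw.bdd_mul (c := ‖f‖) (f.continuous.measurable.comp hφ).aestronglyMeasurable
      (ae_of_all _ fun x => f.norm_coe_le_norm _)
  have hB : ∀ n, 0 ≤ ∫ x, bernsteinApproximation n g (φ x) * w x ∂ρ := by
    intro n
    have h1 : ∀ x, bernsteinApproximation n g (φ x) * w x = ∑ k : Fin (n + 1),
        (n.choose k * g (bernstein.z k)) *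
          ((φ x : ℝ) ^ (k : ℕ) * (1 - (φ x : ℝ)) ^ (n - k) * w x) := by
      intro x
      rw [bernsteinApproximation.apply, Finset.sum_mul]
      refine Finset.sum_congr rfl fun k _ => ?_
      rw [bernstein_apply, smul_eq_mul]
      ring
    simp_rw [h1]
    rw [integral_finsetSum]
    · refine Finset.sum_nonneg fun k _ => ?_
      rw [integral_const_mul]
      exact mul_nonneg (mul_nonneg (Nat.cast_nonneg _) (hg _)) (h _ _)
    · intro k _
      exact (hint ⟨fun y => (y : ℝ) ^ (k : ℕ) * (1 - (y : ℝ)) ^ (n - (k : ℕ)),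
        by fun_prop⟩).const_mul _
  refine ge_of_tendsto' (f := fun n => ∫ x, bernsteinApproximation n g (φ x) * w x ∂ρ)
    (x := atTop) ?_ hB
  have hlim := bernsteinApproximation_uniform g
  obtain ⟨C, hC⟩ := (hlim.norm.bddAbove_range)
  refine tendsto_integral_of_dominated_convergence (fun x => C * ‖w x‖)
    (fun n => (hint _).aestronglyMeasurable) (hw.norm.const_mul C) (fun n => ?_) ?_
  · refine ae_of_all _ fun x => ?_
    rw [norm_mul]
    refine mul_le_mul_of_nonneg_right ?_ (norm_nonneg _)
    exact ((bernsteinApproximation n g).norm_coe_le_norm _).trans (hC ⟨n, rfl⟩)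
  · refine ae_of_all _ fun x => Tendsto.mul_const _ ?_
    exact ((continuous_eval_const (φ x)).tendsto g).comp hlim

/-- An integrable function with nonnegative Hausdorff moments is nonnegative. -/
lemma ae_nonneg_of_bernstein {X : Type*} [MeasurableSpace X] {ρ : Measure X} [SigmaFinite ρ]
    {w : X → ℝ}
    (hw : Integrable w ρ) {φ : X → I} (hφ : Measurable φ) {ψ : I → X} (hψ : Measurable ψ)
    (hψφ : ∀ᵐ x ∂ρ, ψ (φ x) = x)
    (h : ∀ k m : ℕ, 0 ≤ ∫ x, (φ x : ℝ) ^ k * (1 - (φ x : ℝ)) ^ m * w x ∂ρ) :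
    ∀ᵐ x ∂ρ, 0 ≤ w x := by
  set μ := ρ.withDensity fun x => ENNReal.ofReal (-w x) with hμ
  set ν := ρ.withDensity fun x => ENNReal.ofReal (w x) with hν
  have : IsFiniteMeasure μ := isFiniteMeasure_withDensity_ofReal hw.neg.2
  have : IsFiniteMeasure ν := isFiniteMeasure_withDensity_ofReal hw.2
  have hmn : AEMeasurable (fun x => ENNReal.ofReal (-w x)) ρ :=
    hw.1.aemeasurable.neg.ennreal_ofReal
  -- With $\mu,\nu$ the negative and positive parts of $w\rho$, the moment condition gives
  -- $\mu\le\nu$ on the unit interval; the left inverse $\psi$ then carries this back to $X$.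
  have hle : μ.map φ ≤ ν.map φ := by
    refine measure_le_of_forall_integral_le _ _ fun f hf => ?_
    rw [integral_map hφ.aemeasurable f.continuous.aestronglyMeasurable,
      integral_map hφ.aemeasurable f.continuous.aestronglyMeasurable, hμ, hν,
      integral_withDensity_eq_integral_toReal_smul₀ hmn
        (ae_of_all _ fun _ => ENNReal.ofReal_lt_top),
      integral_withDensity_eq_integral_toReal_smul₀ hw.1.aemeasurable.ennreal_ofReal
        (ae_of_all _ fun _ => ENNReal.ofReal_lt_top), ← sub_nonneg, ← integral_sub]
    · refine (integral_mul_nonneg_of_bernstein hw hφ h f hf).trans_eq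
        (integral_congr_ae (ae_of_all _ fun x => ?_))
      simp only [ENNReal.toReal_ofReal', smul_eq_mul]
      rcases le_total 0 (w x) with h0 | h0
      · rw [max_eq_left h0, max_eq_right (by linarith)]; ring
      · rw [max_eq_right h0, max_eq_left (by linarith)]; ring
    · simp only [ENNReal.toReal_ofReal', smul_eq_mul]
      simp_rw [mul_comm _ (f _)]
      exact hw.pos_part.bdd_mul (c := ‖f‖) (f.continuous.measurable.comp hφ).aestronglyMeasurable
        (ae_of_all _ fun x => f.norm_coe_le_norm _)
    · simp only [ENNReal.toReal_ofReal', smul_eq_mul]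
      simp_rw [mul_comm _ (f _)]
      exact hw.neg_part.bdd_mul (c := ‖f‖) (f.continuous.measurable.comp hφ).aestronglyMeasurable
        (ae_of_all _ fun x => f.norm_coe_le_norm _)
  have hback : ∀ κ : Measure X, κ ≪ ρ → (κ.map φ).map ψ = κ := by
    intro κ hκ
    rw [Measure.map_map hψ hφ]
    exact (Measure.map_congr (hκ.ae_le hψφ)).trans Measure.map_id
  have hle' : μ ≤ ν := by
    rw [← hback μ (withDensity_absolutelyContinuous _ _),
      ← hback ν (withDensity_absolutelyContinuous _ _)]
    exact Measure.map_mono hle hψ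
  have hae : (fun x => ENNReal.ofReal (-w x)) ≤ᵐ[ρ] fun x => ENNReal.ofReal (w x) := by
    refine ae_le_of_forall_setLIntegral_le_of_sigmaFinite₀ hmn fun s hs _ => ?_
    rw [← withDensity_apply _ hs, ← withDensity_apply _ hs]
    exact hle' s
  filter_upwards [hae] with x hx
  by_contra! h0
  rw [ENNReal.ofReal_of_nonpos h0.le] at hx
  exact absurd (ENNReal.ofReal_pos.2 (neg_pos.2 h0)) (not_lt.2 hx)

end MomentPositivity

/-! ### Nonnegativity and Laplace transform of the Mittag-Leffler density -/

section MittagLefflerLaplace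

open Filter Topology Set unitInterval

/-- The density of `ML(a, l)` on `(0, ∞)`. -/
def mlDensity (a l x : ℝ) : ℝ := l * x ^ (a - 1) * mittagLeffler a a (-l * x ^ a)

lemma measurable_mlDensity (a l : ℝ) : Measurable (mlDensity a l) := by
  unfold mlDensity mittagLeffler
  refine Measurable.mul (by fun_prop) (Measurable.tsum fun k => ?_)
  fun_prop

/-- The terms of the series of `exp (-u x)` times the density of `ML(a, l)`. -/
def mlTerm (a l u : ℝ) (k : ℕ) (x : ℝ) : ℝ :=
  (-1) ^ k * l ^ (k + 1) / Real.Gamma (a * (k + 1)) *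
    (x ^ (a * (k + 1) - 1) * Real.exp (-(u * x)))

lemma exp_mul_mlDensity_eq_tsum (a l u : ℝ) {x : ℝ} (hx : 0 < x) :
    Real.exp (-(u * x)) * mlDensity a l x = ∑' k, mlTerm a l u k x := by
  rw [mlDensity, mittagLeffler, ← mul_assoc, ← tsum_mul_left]
  refine tsum_congr fun k => ?_
  have h1 : x ^ (a * (k + 1) - 1) = x ^ (a - 1) * (x ^ a) ^ k := by
    rw [← Real.rpow_natCast, ← Real.rpow_mul hx.le, ← Real.rpow_add hx]
    ring_nf
  rw [mlTerm, h1, mul_add, mul_one, neg_mul, neg_pow, mul_pow, pow_succ]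
  ring

lemma integrableOn_rpow_mul_exp_neg_mul {s u : ℝ} (hs : 0 < s) (hu : 0 < u) :
    IntegrableOn (fun x : ℝ => x ^ (s - 1) * Real.exp (-(u * x))) (Ioi 0) := by
  have := integrableOn_rpow_mul_exp_neg_mul_rpow (s := s - 1) (by linarith) one_pos hu
  refine this.congr_fun (fun x _ => ?_) measurableSet_Ioi
  simp

lemma integrableOn_mlTerm {a l u : ℝ} (ha : 0 < a) (hu : 0 < u) (k : ℕ) :
    IntegrableOn (mlTerm a l u k) (Ioi 0) :=
  (integrableOn_rpow_mul_exp_neg_mul (by positivity) hu).const_mul _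

lemma integral_mlTerm {a l u : ℝ} (ha : 0 < a) (hu : 0 < u) (k : ℕ) :
    ∫ x in Ioi 0, mlTerm a l u k x = l / u ^ a * (-(l / u ^ a)) ^ k := by
  have hs : 0 < a * ((k : ℝ) + 1) := by positivity
  unfold mlTerm
  rw [integral_const_mul, Real.integral_rpow_mul_exp_neg_mul_Ioi hs hu, one_div,
    Real.inv_rpow hu.le, Real.rpow_mul hu.le, neg_pow (l / u ^ a), ← Nat.cast_add_one, Real.rpow_natCast,
    div_pow]
  have h1 := (Real.Gamma_pos_of_pos hs).ne'
  have h2 := (Real.rpow_pos_of_pos hu a).ne'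
  push_cast
  field_simp
  ring

lemma integral_norm_mlTerm {a l u : ℝ} (ha : 0 < a) (hl : 0 < l) (hu : 0 < u) (k : ℕ) :
    ∫ x in Ioi 0, ‖mlTerm a l u k x‖ = l / u ^ a * (l / u ^ a) ^ k := by
  have hs : 0 < a * ((k : ℝ) + 1) := by positivity
  have h0 : ∀ x ∈ Ioi (0 : ℝ), ‖mlTerm a l u k x‖ = (-1) ^ k * mlTerm a l u k x := by
    intro x hx
    have h1 := Real.Gamma_pos_of_pos hs
    have h2 : 0 < x ^ (a * ((k : ℝ) + 1) - 1) := Real.rpow_pos_of_pos hx _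
    rw [mlTerm, norm_mul, norm_div, norm_mul, norm_pow, norm_neg, norm_one, one_pow, one_mul,
      Real.norm_of_nonneg (by positivity), Real.norm_of_nonneg h1.le,
      Real.norm_of_nonneg (by positivity), mul_div_assoc, mul_assoc, ← mul_assoc ((-1 : ℝ) ^ k),
      ← mul_pow]
    norm_num
  rw [setIntegral_congr_fun measurableSet_Ioi h0, integral_const_mul, integral_mlTerm ha hu,
    neg_pow (l / u ^ a), mul_left_comm, ← mul_assoc ((-1 : ℝ) ^ k), ← mul_pow]
  norm_num

/-- The norms form a geometric series of ratio $l/u^a$, whence the restriction to large $u$. -/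
lemma summable_integral_norm_mlTerm {a l u : ℝ} (ha : 0 < a) (hl : 0 < l) (hu : 0 < u)
    (hlu : l < u ^ a) : Summable fun k => ∫ x in Ioi 0, ‖mlTerm a l u k x‖ := by
  simp_rw [integral_norm_mlTerm ha hl hu]
  refine (summable_geometric_of_lt_one (by positivity) ?_).mul_left _
  rwa [div_lt_one (by positivity)]

lemma integrable_tsum_of_summable_integral_norm {X : Type*} [MeasurableSpace X] {μ : Measure X}
    {F : ℕ → X → ℝ} (hF : ∀ i, Integrable (F i) μ) (hm : ∀ i, Measurable (F i))
    (hs : Summable fun i => ∫ x, ‖F i x‖ ∂μ) : Integrable (fun x => ∑' i, F i x) μ := by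
  refine ⟨(Measurable.tsum hm).aestronglyMeasurable, ?_⟩
  calc ∫⁻ x, ‖∑' i, F i x‖ₑ ∂μ ≤ ∫⁻ x, ∑' i, ‖F i x‖ₑ ∂μ :=
        lintegral_mono fun x => enorm_tsum_le_tsum_enorm
    _ = ∑' i, ∫⁻ x, ‖F i x‖ₑ ∂μ := lintegral_tsum fun i => (hm i).enorm.aemeasurable
    _ = ∑' i, ENNReal.ofReal (∫ x, ‖F i x‖ ∂μ) := by
        simp_rw [ofReal_integral_norm_eq_lintegral_enorm (hF _)]
    _ < ∞ := (hs.tsum_ofReal_lt_top)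

lemma integrableOn_exp_mul_mlDensity {a l u : ℝ} (ha : 0 < a) (hl : 0 < l) (hu : 0 < u)
    (hlu : l < u ^ a) : IntegrableOn (fun x => Real.exp (-(u * x)) * mlDensity a l x) (Ioi 0) := by
  refine IntegrableOn.congr_fun ?_ (fun x hx => (exp_mul_mlDensity_eq_tsum a l u hx).symm)
    measurableSet_Ioi
  refine integrable_tsum_of_summable_integral_norm (integrableOn_mlTerm ha hu) (fun k => ?_)
    (summable_integral_norm_mlTerm ha hl hu hlu)
  unfold mlTerm
  fun_prop

lemma integral_exp_mul_mlDensity {a l u : ℝ} (ha : 0 < a) (hl : 0 < l) (hu : 0 < u)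
    (hlu : l < u ^ a) :
    ∫ x in Ioi 0, Real.exp (-(u * x)) * mlDensity a l x = l / (l + u ^ a) := by
  rw [setIntegral_congr_fun measurableSet_Ioi fun x hx => exp_mul_mlDensity_eq_tsum a l u hx,
    ← integral_tsum_of_summable_integral_norm (integrableOn_mlTerm ha hu)
      (summable_integral_norm_mlTerm ha hl hu hlu)]
  have hpos : 0 < u ^ a := by positivity
  simp_rw [integral_mlTerm ha hu]
  rw [tsum_mul_left, tsum_geometric_of_abs_lt_one]
  · rw [sub_neg_eq_add]
    field_simp
    rw [add_comm]
  · rw [abs_neg, abs_of_pos (by positivity), div_lt_one hpos]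
    exact hlu

/-- Alternating differences of the Laplace transform are moments. -/
lemma integral_one_sub_exp_pow_mul_mlDensity {a l : ℝ} (ha : 0 < a) (hl : 0 < l) (m : ℕ) :
    ∀ u, 0 < u → l < u ^ a →
    ∫ x in Ioi 0, (1 - Real.exp (-x)) ^ m * (Real.exp (-(u * x)) * mlDensity a l x) =
      nabla^[m] (fun x : ℝ => l / (l + x ^ a)) u := by
  have hint : ∀ (m : ℕ) (u : ℝ), 0 < u → l < u ^ a →
      IntegrableOn (fun x => (1 - Real.exp (-x)) ^ m * (Real.exp (-(u * x)) * mlDensity a l x))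
        (Ioi 0) := by
    intro m u hu hlu
    refine (integrableOn_exp_mul_mlDensity ha hl hu hlu).bdd_mul (c := 1)
      (by fun_prop) ?_
    filter_upwards [ae_restrict_mem measurableSet_Ioi] with x hx
    have h1 : Real.exp (-x) ≤ 1 := Real.exp_le_one_iff.2 (by linarith [mem_Ioi.1 hx])
    rw [norm_pow]
    refine pow_le_one₀ (norm_nonneg _) ?_
    rw [Real.norm_of_nonneg (by linarith)]
    linarith [Real.exp_pos (-x)]
  induction m with
  | zero =>
    intro u hu hlu
    simpa using integral_exp_mul_mlDensity ha hl hu hlu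
  | succ m ih =>
    intro u hu hlu
    have hu1 : 0 < u + 1 := by linarith
    have hlu1 : l < (u + 1) ^ a := hlu.trans (Real.rpow_lt_rpow hu.le (by linarith) ha)
    rw [Function.iterate_succ_apply', nabla, ← ih u hu hlu, ← ih (u + 1) hu1 hlu1,
      ← integral_sub (hint m u hu hlu) (hint m (u + 1) hu1 hlu1)]
    refine integral_congr_ae (ae_of_all _ fun x => ?_)
    have : Real.exp (-((u + 1) * x)) = Real.exp (-(u * x)) * Real.exp (-x) := by
      rw [← Real.exp_add]; ring_nf
    simp only [this]
    ring

/-- Weight the density by $e^{-cx}$ with $c^a>l$ and substitute $y=e^{-x}$. The Hausdorff moments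
become $m$-th alternating differences of $l/(l+x^a)$ at $c+k$, within the range where the transform
is known. -/
theorem mlDensity_ae_nonneg {a l : ℝ} (ha0 : 0 < a) (ha1 : a ≤ 1) (hl : 0 < l) :
    ∀ᵐ x ∂volume.restrict (Ioi (0 : ℝ)), 0 ≤ mlDensity a l x := by
  obtain ⟨c, hc, hlc⟩ : ∃ c : ℝ, 0 < c ∧ l < c ^ a := by
    -- Chosen so that $c^a=l+1$.
    refine ⟨(l + 1) ^ a⁻¹, by positivity, ?_⟩
    rw [← Real.rpow_mul (by positivity), inv_mul_cancel₀ ha0.ne', Real.rpow_one]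
    linarith
  have key : ∀ᵐ x ∂volume.restrict (Ioi (0 : ℝ)), 0 ≤ Real.exp (-(c * x)) * mlDensity a l x := by
    refine ae_nonneg_of_bernstein (φ := fun x => projIcc 0 1 zero_le_one (Real.exp (-x)))
      (ψ := fun y => -Real.log y) (integrableOn_exp_mul_mlDensity ha0 hl hc hlc)
      (continuous_projIcc.measurable.comp (by fun_prop))
      (Real.measurable_log.comp measurable_subtype_coe).neg ?_ ?_
    · filter_upwards [ae_restrict_mem measurableSet_Ioi] with x hx
      rw [projIcc_of_mem zero_le_one
        ⟨(Real.exp_pos _).le, Real.exp_le_one_iff.2 (by linarith [mem_Ioi.1 hx])⟩]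
      simp
    · intro k m
      have hck : 0 < c + k := by positivity
      have hlck : l < (c + k) ^ a :=
        hlc.trans_le (Real.rpow_le_rpow hc.le (by simp) ha0.le)
      have h1 := integral_one_sub_exp_pow_mul_mlDensity ha0 hl m (c + k) hck hlck
      rw [setIntegral_congr_fun (g := fun x => (1 - Real.exp (-x)) ^ m *
        (Real.exp (-((c + k) * x)) * mlDensity a l x)) measurableSet_Ioi, h1]
      · exact nabla_iterate_mlTransform_nonneg m ha0 ha1 hl hck
      · intro x hx
        simp only
        rw [projIcc_of_mem zero_le_one
          ⟨(Real.exp_pos _).le, Real.exp_le_one_iff.2 (by linarith [mem_Ioi.1 hx])⟩]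
        have : Real.exp (-((c + k) * x)) = Real.exp (-x) ^ k * Real.exp (-(c * x)) := by
          rw [← Real.exp_nat_mul, ← Real.exp_add]; ring_nf
        simp only [this]
        ring
  filter_upwards [key] with x hx
  exact nonneg_of_mul_nonneg_right hx (Real.exp_pos _)

lemma mlMeasure_eq (a l : ℝ) : mlMeasure a l =
    (volume.restrict (Ioi 0)).withDensity fun x => ENNReal.ofReal (mlDensity a l x) := rfl

lemma mlMeasure_absolutelyContinuous (a l : ℝ) : mlMeasure a l ≪ volume :=
  (withDensity_absolutelyContinuous _ _).trans Measure.restrict_le_self.absolutelyContinuous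

lemma ae_mlMeasure_pos (a l : ℝ) : ∀ᵐ x ∂mlMeasure a l, 0 < x :=
  (withDensity_absolutelyContinuous _ _).ae_le (ae_restrict_mem measurableSet_Ioi)

/-- The Laplace transform of the Mittag-Leffler distribution. -/
theorem integral_exp_mlMeasure {a l : ℝ} (ha0 : 0 < a) (ha1 : a ≤ 1) (hl : 0 < l)
    [IsProbabilityMeasure (mlMeasure a l)] {u : ℝ} (hu : 0 ≤ u) :
    ∫ x, Real.exp (-(u * x)) ∂mlMeasure a l = l / (l + u ^ a) := by
  have hlarge : ∀ u : ℝ, 0 < u → l < u ^ a →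
      ∫ x, Real.exp (-(u * x)) ∂mlMeasure a l = l / (l + u ^ a) := by
    intro u hu hlu
    rw [mlMeasure_eq, integral_withDensity_eq_integral_toReal_smul
      (measurable_mlDensity a l).ennreal_ofReal (ae_of_all _ fun _ => ENNReal.ofReal_lt_top),
      ← integral_exp_mul_mlDensity ha0 hl hu hlu]
    refine integral_congr_ae ?_
    filter_upwards [mlDensity_ae_nonneg ha0 ha1 hl] with x hx
    rw [ENNReal.toReal_ofReal hx, smul_eq_mul, mul_comm]
  rcases hu.eq_or_lt with rfl | hu
  · simp [Real.zero_rpow ha0.ne', hl.ne']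
  -- Both sides, as functions of $t=-u$, are analytic on the negative half-line and agree far to the
  -- left, so the identity theorem gives all $u>0$.
  have hset : Iio (0 : ℝ) ⊆ interior (integrableExpSet id (mlMeasure a l)) := by
    refine interior_maximal (fun t ht => ?_) isOpen_Iio
    refine (integrable_const (1 : ℝ)).mono' (by fun_prop) ?_
    filter_upwards [ae_mlMeasure_pos a l] with x hx
    rw [Real.norm_of_nonneg (Real.exp_pos _).le]
    exact Real.exp_le_one_iff.2 (mul_nonpos_of_nonpos_of_nonneg (le_of_lt ht) hx.le)
  have h1 : AnalyticOnNhd ℝ (mgf id (mlMeasure a l)) (Iio 0) :=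
    analyticOnNhd_mgf.mono hset
  have h2 : AnalyticOnNhd ℝ (fun t : ℝ => l / (l + (-t) ^ a)) (Iio 0) := by
    intro t ht
    have ht' : 0 < -t := neg_pos.2 ht
    have h3 : AnalyticAt ℝ (fun x : ℝ => x ^ a) (-t) :=
      (Real.contDiffAt_rpow_const_of_ne (n := ⊤) ht'.ne').analyticAt
    have h4 : AnalyticAt ℝ (fun t : ℝ => (-t) ^ a) t :=
      h3.comp (g := fun x : ℝ => x ^ a) (f := fun t : ℝ => -t) analyticAt_id.neg
    exact analyticAt_const.div (analyticAt_const.add h4) (by positivity)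
  have hev : ∀ᶠ u : ℝ in atTop, 0 < u ∧ l < u ^ a :=
    (eventually_gt_atTop 0).and ((tendsto_rpow_atTop ha0).eventually_gt_atTop l)
  obtain ⟨c, hc⟩ := eventually_atTop.1 hev
  have h3 : mgf id (mlMeasure a l) =ᶠ[𝓝 (-(c + 1))] fun t : ℝ => l / (l + (-t) ^ a) := by
    filter_upwards [Iio_mem_nhds (show -(c + 1) < -c by linarith)] with t ht
    obtain ⟨h4, h5⟩ := hc (-t) (by linarith [mem_Iio.1 ht])
    rw [← hlarge _ h4 h5, mgf]
    simp
  have h6 := h1.eqOn_of_preconnected_of_eventuallyEq h2 isPreconnected_Iio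
    (show -(c + 1) ∈ Iio (0 : ℝ) by rw [mem_Iio]; linarith [(hc c le_rfl).1]) h3
    (show -u ∈ Iio (0 : ℝ) by rw [mem_Iio]; linarith)
  simp only [mgf, neg_neg] at h6
  rw [← h6]
  simp

end MittagLefflerLaplace

/-! ### First-step equations of the killed jump chain -/

section KilledChain

open Filter Topology

variable {ι : Type*} [Fintype ι] [DecidableEq ι]

/-- Sums over paths are matrix powers. -/
lemma sum_paths_eq_dotProduct_pow_mulVec {S : Type*} [Fintype S] [DecidableEq S]
    (M : Matrix S S ℝ) (f : S → ℝ) (N : ℕ) (μ : S → ℝ) :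
    ∑ x : Fin (N + 1) → S, μ (x 0) * (∏ k : Fin N, M (x k.castSucc) (x k.succ)) * f (x (Fin.last N))
      = μ ⬝ᵥ ((M ^ N) *ᵥ f) := by
  induction N generalizing μ with
  | zero =>
    rw [pow_zero, Matrix.one_mulVec, dotProduct]
    exact Fintype.sum_equiv (Equiv.funUnique (Fin 1) S) _ _ fun x => by simp
  | succ N ih =>
    rw [pow_succ', ← Matrix.mulVec_mulVec, Matrix.dotProduct_mulVec, ← ih,
      ← Fintype.sum_equiv (Fin.consEquiv fun _ => S)
        (fun p : S × (Fin (N + 1) → S) => μ p.1 * (M p.1 (p.2 0) *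
          ∏ k : Fin N, M (p.2 k.castSucc) (p.2 k.succ)) * f (p.2 (Fin.last N)))]
    · rw [Fintype.sum_prod_type_right]
      refine Finset.sum_congr rfl fun x _ => ?_
      simp only [Matrix.vecMul, dotProduct, Finset.sum_mul]
      refine Finset.sum_congr rfl fun y _ => ?_
      ring
    · intro p
      simp [Fin.prod_univ_succ, Fin.consEquiv, ← Fin.succ_last]

/-- The transition matrix of the jump chain killed with probability `1 - g i` at the phase `i`. -/
def killedMatrix (g : ι → ℝ) (T : Matrix ι ι ℝ) : Matrix (Option ι) (Option ι) ℝ :=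
  fun x y => x.elim 1 g * jumpMatrix T x y

lemma sum_jumpMatrix (T : Matrix ι ι ℝ) (hd : ∀ i, T i i < 0) (x : Option ι) :
    ∑ y, jumpMatrix T x y = 1 := by
  rcases x with _ | i
  · simp [Fintype.sum_option, jumpMatrix]
  · have hi := (hd i).ne
    have h1 : ∑ j, jumpMatrix T (some i) (some j) = (∑ j, T i j - T i i) / (-T i i) := by
      rw [← Finset.sum_erase_eq_sub (Finset.mem_univ i), Finset.sum_div,
        ← Finset.sum_erase (a := i) Finset.univ (by simp [jumpMatrix])]
      refine Finset.sum_congr rfl fun j hj => ?_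
      simp [jumpMatrix, (Finset.ne_of_mem_erase hj).symm]
    rw [Fintype.sum_option, h1]
    simp only [jumpMatrix, exitRates_apply]
    field_simp
    ring

/-- Multiplying one step of the killed chain by $\lambda_i=-t_{ii}$ clears the denominators of the
jump matrix; the term $-t_{ii}v_i$ compensates for $q_{ii}=0$. -/
lemma killedMatrix_mulVec_some {T : Matrix ι ι ℝ} (hd : ∀ i, T i i < 0) (g : ι → ℝ)
    {v : Option ι → ℝ} (hv : v none = 1) (i : ι) :
    -T i i * (killedMatrix g T *ᵥ v) (some i) =
      g i * ((T *ᵥ fun j => v (some j)) i - T i i * v (some i) + exitRates T i) := by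
  have hi := (hd i).ne
  have h1 : ∑ j, jumpMatrix T (some i) (some j) * v (some j) =
      ((T *ᵥ fun j => v (some j)) i - T i i * v (some i)) / (-T i i) := by
    rw [Matrix.mulVec, dotProduct, ← Finset.sum_erase_eq_sub (Finset.mem_univ i), Finset.sum_div,
      ← Finset.sum_erase (a := i) Finset.univ (by simp [jumpMatrix])]
    refine Finset.sum_congr rfl fun j hj => ?_
    simp [jumpMatrix, (Finset.ne_of_mem_erase hj).symm]
    ring
  have h2 : (killedMatrix g T *ᵥ v) (some i) = g i * (jumpMatrix T (some i) none +
      ∑ j, jumpMatrix T (some i) (some j) * v (some j)) := by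
    simp only [Matrix.mulVec, dotProduct, killedMatrix, Option.elim_some, Fintype.sum_option, hv,
      Finset.mul_sum, mul_one, mul_add, mul_assoc]
  rw [h2, h1]
  simp only [jumpMatrix]
  field_simp
  ring

/-- The absorption probabilities of the killed chain. -/
lemma exists_tendsto_killedMatrix_pow {T : Matrix ι ι ℝ} (hT : IsTransientSubIntensity T)
    {g : ι → ℝ} (hg0 : ∀ i, 0 ≤ g i) (hg1 : ∀ i, g i ≤ 1) :
    ∃ v : ι → ℝ, (∀ i, -T i i * v i = g i * ((T *ᵥ v) i - T i i * v i + exitRates T i)) ∧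
      ∀ i, Tendsto (fun N => (killedMatrix g T ^ N *ᵥ Pi.single none 1) (some i)) atTop
        (𝓝 (v i)) := by
  set M := killedMatrix g T with hM
  set e : Option ι → ℝ := Pi.single none 1 with he
  have hQ := jumpMatrix_nonneg hT.diag_neg hT.offDiag_nonneg hT.exit_nonneg
  have hg0' : ∀ x : Option ι, 0 ≤ x.elim 1 g := by
    rintro (_ | i)
    exacts [zero_le_one, hg0 i]
  have hg1' : ∀ x : Option ι, x.elim 1 g ≤ 1 := by
    rintro (_ | i)
    exacts [le_rfl, hg1 i]
  have hM0 : ∀ x y, 0 ≤ M x y := fun x y => mul_nonneg (hg0' x) (hQ x y)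
  have hmono : ∀ v w : Option ι → ℝ, v ≤ w → M *ᵥ v ≤ M *ᵥ w := fun v w h x =>
    Finset.sum_le_sum fun y _ => mul_le_mul_of_nonneg_left (h y) (hM0 x y)
  have he0 : 0 ≤ e := Pi.single_nonneg.2 zero_le_one
  -- As the state `none` is absorbing, $M^Ne$ increases with $N$; it is bounded by $1$, and its
  -- limit is a fixed point of $M$.
  have hstep : e ≤ M *ᵥ e := by
    rintro (_ | i)
    · simp [he, hM, killedMatrix, jumpMatrix]
    · simp [he, hM0]
  have hone : M *ᵥ 1 ≤ 1 := by
    intro x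
    simp only [Matrix.mulVec, dotProduct, Pi.one_apply, mul_one, hM, killedMatrix,
      ← Finset.mul_sum, sum_jumpMatrix T hT.diag_neg]
    exact hg1' x
  have hsucc : ∀ N, M ^ (N + 1) *ᵥ e = M *ᵥ (M ^ N *ᵥ e) := fun N => by
    rw [pow_succ', Matrix.mulVec_mulVec]
  have hmon : Monotone fun N => M ^ N *ᵥ e := by
    refine monotone_nat_of_le_succ fun N => ?_
    induction N with
    | zero => simpa using hstep
    | succ N ih =>
      rw [hsucc, hsucc (N + 1)]
      exact hmono _ _ ih
  have hle : ∀ N, M ^ N *ᵥ e ≤ 1 := by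
    intro N
    induction N with
    | zero =>
      rw [pow_zero, Matrix.one_mulVec]
      intro x
      simp only [he, Pi.single_apply, Pi.one_apply]
      split_ifs <;> norm_num
    | succ N ih =>
      rw [hsucc]
      exact (hmono _ _ ih).trans hone
  set v : Option ι → ℝ := fun x => ⨆ N, (M ^ N *ᵥ e) x with hv
  have hlim : ∀ x, Tendsto (fun N => (M ^ N *ᵥ e) x) atTop (𝓝 (v x)) := fun x =>
    tendsto_atTop_ciSup (fun m n h => hmon h x) ⟨1, by rintro _ ⟨N, rfl⟩; exact hle N x⟩
  have hfix : M *ᵥ v = v := by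
    ext x
    refine tendsto_nhds_unique (f := fun N => (M ^ (N + 1) *ᵥ e) x) (l := atTop) ?_
      ((tendsto_add_atTop_iff_nat 1).2 (hlim x))
    simp_rw [hsucc]
    exact tendsto_finsetSum _ fun y _ => (hlim y).const_mul (M x y)
  have hnone : v none = 1 := by
    refine tendsto_nhds_unique (hlim none) (tendsto_const_nhds.congr fun N => ?_)
    refine le_antisymm ?_ (hle N none)
    have := hmon (Nat.zero_le N) none
    simpa [he] using this
  refine ⟨fun i => v (some i), fun i => ?_, fun i => hlim (some i)⟩
  have := killedMatrix_mulVec_some hT.diag_neg g hnone i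
  rw [← hM, hfix] at this
  exact this

end KilledChain

/-! ### Multiplicative functionals of the chain and the holding times -/

section PathLaw

open Filter Topology

variable {ι : Type*} [Fintype ι] [DecidableEq ι] {Ω : Type*} [MeasurableSpace Ω] {P : Measure Ω}
  {a : ℝ} {π : ι → ℝ} {T : Matrix ι ι ℝ} {J : ℕ → Ω → Option ι} {H : ι → ℕ → Ω → ℝ}

/-- The event that the chain follows a given finite path. -/
def pathEvent {ι Ω : Type*} (J : ℕ → Ω → Option ι) {N : ℕ} (x : Fin (N + 1) → Option ι) : Set Ω :=
  {ω | ∀ k : Fin (N + 1), J k ω = x k}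

namespace IsMLMarkovRenewal

lemma measurableSet_pathEvent (hJH : IsMLMarkovRenewal P a π T J H) {N : ℕ}
    (x : Fin (N + 1) → Option ι) : MeasurableSet (pathEvent J x) := by
  rw [pathEvent, Set.ofPred_forall]
  exact MeasurableSet.iInter fun k => hJH.measurable_chain k (MeasurableSpace.measurableSet_top
    (s := {x k}))

lemma measurableSet_chain_eq (hJH : IsMLMarkovRenewal P a π T J H) (n : ℕ) (x : Option ι) :
    MeasurableSet {ω | J n ω = x} :=
  hJH.measurable_chain n (MeasurableSpace.measurableSet_top (s := {x}))

lemma measure_pathEvent (hJH : IsMLMarkovRenewal P a π T J H) {N : ℕ}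
    (x : Fin (N + 1) → Option ι) :
    P (pathEvent J x) = ENNReal.ofReal
      ((x 0).elim 0 π * ∏ k : Fin N, jumpMatrix T (x k.castSucc) (x k.succ)) := by
  have h := hJH.chain_law N fun k => x (Fin.ofNat (N + 1) k)
  have h1 : pathEvent J x = {ω | ∀ k ≤ N, J k ω = x (Fin.ofNat (N + 1) k)} := by
    ext ω
    refine ⟨fun h k hk => ?_, fun h k => ?_⟩
    · have := h (Fin.ofNat (N + 1) k)
      rwa [Fin.val_ofNat, Nat.mod_eq_of_lt (by omega)] at this
    · have := h k (by omega)
      rwa [Fin.ofNat_val_eq_self] at this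
  rw [h1, h, Finset.prod_range]
  congr 2
  refine Finset.prod_congr rfl fun k _ => ?_
  congr 2 <;> ext <;> simp [Nat.mod_eq_of_lt]

lemma setLIntegral_pathEvent (hJH : IsMLMarkovRenewal P a π T J H) {N : ℕ}
    (x : Fin (N + 1) → Option ι) {F : (ι × ℕ → ℝ) → ℝ≥0∞} (hF : Measurable F) :
    ∫⁻ ω in pathEvent J x, F (fun q => H q.1 q.2 ω) ∂P =
      P (pathEvent J x) * ∫⁻ ω, F (fun q => H q.1 q.2 ω) ∂P := by
  set B : Set (ℕ → Option ι) := {y | ∀ k : Fin (N + 1), y k = x k} with hB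
  have hBm : MeasurableSet B := by
    rw [hB, Set.ofPred_forall]
    refine MeasurableSet.iInter fun k => ?_
    have hk : Measurable fun y : ℕ → Option ι => y k := measurable_pi_apply _
    exact hk (MeasurableSpace.measurableSet_top (s := {x k}))
  have hJm : Measurable fun (ω : Ω) (n : ℕ) => J n ω := measurable_pi_lambda _ hJH.measurable_chain
  have hHm : Measurable fun (ω : Ω) (q : ι × ℕ) => H q.1 q.2 ω :=
    measurable_pi_lambda _ fun q => hJH.measurable_hold q.1 q.2
  have hind : Measurable (B.indicator (1 : (ℕ → Option ι) → ℝ≥0∞)) := measurable_one.indicator hBm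
  have h := lintegral_mul_eq_lintegral_mul_lintegral_of_indepFun (hind.comp hJm) (hF.comp hHm)
    (hJH.indep_chain_hold.comp hind hF)
  have hE := hJH.measurableSet_pathEvent x
  have h1 : ∀ ω, (B.indicator (1 : (ℕ → Option ι) → ℝ≥0∞) ∘ fun (ω : Ω) (n : ℕ) => J n ω) ω =
      (pathEvent J x).indicator 1 ω := fun ω => rfl
  rw [← lintegral_indicator hE]
  simp only [Pi.mul_apply, h1] at h
  rw [lintegral_indicator_one hE] at h
  rw [← Function.comp_def F, ← h]
  refine lintegral_congr fun ω => ?_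
  by_cases hω : ω ∈ pathEvent J x <;> simp [hω]

/-- Along a fixed path the time index alone makes the pairs (phase, time) distinct, so repeated
phases do no harm. At `none` a dummy phase `i₀` is used and its variable is replaced by the constant
`c`. -/
lemma iIndepFun_hold (hJH : IsMLMarkovRenewal P a π T J H) [Nonempty ι] {β : Type*}
    [MeasurableSpace β] {N : ℕ} (x : Fin N → Option ι) (c : β) {h : ι → ℝ → β}
    (hh : ∀ i, Measurable (h i)) :
    iIndepFun (fun k ω => (x k).elim c fun i => h i (H i k ω)) P := by
  obtain ⟨i₀⟩ := ‹Nonempty ι›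
  have h1 := hJH.indep_hold.precomp (g := fun k : Fin N => ((x k).getD i₀, (k : ℕ)))
    fun k l hkl => Fin.ext (Prod.ext_iff.1 hkl).2
  have h2 := h1.comp (fun k => (x k).elim (fun _ => c) h) fun k => by
    rcases hk : x k with _ | i
    · exact measurable_const
    · exact hh i
  refine (iIndepFun_congr fun k => ae_of_all _ fun ω => ?_).1 h2
  rcases x k with _ | i <;> simp

lemma measurable_hold_elim (hJH : IsMLMarkovRenewal P a π T J H) {β : Type*}
    [MeasurableSpace β] (k : ℕ) (y : Option ι) (c : β) {h : ι → ℝ → β}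
    (hh : ∀ i, Measurable (h i)) : Measurable fun ω => y.elim c fun i => h i (H i k ω) := by
  rcases y with _ | i
  · exact measurable_const
  · exact (hh i).comp (hJH.measurable_hold i k)

lemma lintegral_prod_hold (hJH : IsMLMarkovRenewal P a π T J H) [Nonempty ι]
    [IsProbabilityMeasure P] {N : ℕ}
    (x : Fin N → Option ι) {h : ι → ℝ → ℝ≥0∞} (hh : ∀ i, Measurable (h i)) :
    ∫⁻ ω, ∏ k, (x k).elim 1 (fun i => h i (H i k ω)) ∂P =
      ∏ k, (x k).elim 1 fun i => ∫⁻ y, h i y ∂mlMeasure a (-T i i) := by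
  rw [lintegral_prod_eq_prod_lintegral_of_indepFun Finset.univ
    (fun k ω => (x k).elim 1 fun i => h i (H i k ω)) (hJH.iIndepFun_hold x 1 hh)
    (fun k => hJH.measurable_hold_elim k (x k) 1 hh)]
  refine Finset.prod_congr rfl fun k _ => ?_
  rcases x k with _ | i
  · simp
  · simp only [Option.elim_some]
    rw [← hJH.hold_law i k, lintegral_map (hh i) (hJH.measurable_hold i k)]

end IsMLMarkovRenewal

/-- The product of `h i` evaluated at the first `N` holding times. -/
def holdProd {ι Ω : Type*} (h : ι → ℝ → ℝ≥0∞) (J : ℕ → Ω → Option ι) (H : ι → ℕ → Ω → ℝ) (N : ℕ)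
    (ω : Ω) : ℝ≥0∞ :=
  ∏ k ∈ Finset.range N, (J k ω).elim 1 fun i => h i (H i k ω)

namespace IsMLMarkovRenewal

/-- Decompose over the paths of length $N$. On each the expectation factorises into the path
probability and the factors $g$, which together are products of entries of the killed matrix; the
sum over paths is a matrix power. -/
lemma setLIntegral_holdProd (hJH : IsMLMarkovRenewal P a π T J H) [Nonempty ι]
    [IsProbabilityMeasure P] (hT : IsTransientSubIntensity T) (hπ0 : ∀ i, 0 ≤ π i)
    {h : ι → ℝ → ℝ≥0∞} (hh : ∀ i, Measurable (h i)) {g : ι → ℝ} (hg0 : ∀ i, 0 ≤ g i)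
    (hg : ∀ i, ∫⁻ y, h i y ∂mlMeasure a (-T i i) = ENNReal.ofReal (g i)) (N : ℕ) :
    ∫⁻ ω in {ω | J N ω = none}, holdProd h J H N ω ∂P =
      ENNReal.ofReal (∑ i, π i * (killedMatrix g T ^ N *ᵥ Pi.single none 1) (some i)) := by
  set f : Option ι → ℝ := Pi.single none 1 with hf
  have hQ := jumpMatrix_nonneg hT.diag_neg hT.offDiag_nonneg hT.exit_nonneg
  have hπ0' : ∀ x : Option ι, 0 ≤ x.elim 0 π := by
    rintro (_ | i)
    exacts [le_rfl, hπ0 i]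
  have hg0' : ∀ x : Option ι, 0 ≤ x.elim 1 g := by
    rintro (_ | i)
    exacts [zero_le_one, hg0 i]
  have hf0 : 0 ≤ f := Pi.single_nonneg.2 zero_le_one
  have hK : ∀ x y, 0 ≤ killedMatrix g T x y := fun x y => mul_nonneg (hg0' x) (hQ x y)
  let F : (Fin (N + 1) → Option ι) → (ι × ℕ → ℝ) → ℝ≥0∞ := fun x y =>
    (∏ k : Fin N, (x k.castSucc).elim 1 fun i => h i (y (i, k))) * ENNReal.ofReal (f (x (Fin.last N)))
  have hF : ∀ x, Measurable (F x) := by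
    intro x
    refine Measurable.mul_const (Finset.measurable_prod _ fun k _ => ?_) _
    rcases x k.castSucc with _ | i
    · exact measurable_const
    · exact (hh i).comp (measurable_pi_apply _)
  have hHm : Measurable fun (ω : Ω) (q : ι × ℕ) => H q.1 q.2 ω :=
    measurable_pi_lambda _ fun q => hJH.measurable_hold q.1 q.2
  have h1 : ∀ ω, {ω | J N ω = none}.indicator (holdProd h J H N) ω =
      ∑ x : Fin (N + 1) → Option ι,
        (pathEvent J x).indicator (fun ω => F x fun q => H q.1 q.2 ω) ω := by
    intro ω
    rw [Finset.sum_eq_single (fun k : Fin (N + 1) => J k ω)]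
    · rw [Set.indicator_of_mem (show ω ∈ pathEvent J _ from fun k => rfl)]
      by_cases hω : J N ω = none
      · rw [Set.indicator_of_mem (show ω ∈ {ω | J N ω = none} from hω), holdProd,
          Finset.prod_range]
        simp [F, hf, hω]
      · rw [Set.indicator_of_notMem (show ω ∉ {ω | J N ω = none} from hω)]
        simp [F, hf, hω]
    · intro x _ hx
      refine Set.indicator_of_notMem (fun hω => hx (funext fun k => (hω k).symm)) _
    · simp
  have h2 : ∀ x : Fin (N + 1) → Option ι,
      ∫⁻ ω in pathEvent J x, F x (fun q => H q.1 q.2 ω) ∂P = ENNReal.ofReal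
        ((x 0).elim 0 π * (∏ k : Fin N, killedMatrix g T (x k.castSucc) (x k.succ)) *
          f (x (Fin.last N))) := by
    intro x
    have hg' : ∀ k : Fin N, ((x k.castSucc).elim 1 fun i => ∫⁻ y, h i y ∂mlMeasure a (-T i i)) =
        ENNReal.ofReal ((x k.castSucc).elim 1 g) := by
      intro k
      rcases x k.castSucc with _ | i
      · simp
      · exact hg i
    have h3 : ∫⁻ ω, F x (fun q => H q.1 q.2 ω) ∂P =
        (∏ k : Fin N, ENNReal.ofReal ((x k.castSucc).elim 1 g)) *
          ENNReal.ofReal (f (x (Fin.last N))) := by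
      simp only [← hg']
      rw [← hJH.lintegral_prod_hold (fun k => x k.castSucc) hh]
      exact lintegral_mul_const _ (Finset.measurable_prod _ fun k _ =>
        hJH.measurable_hold_elim k (x k.castSucc) 1 hh)
    rw [hJH.setLIntegral_pathEvent x (hF x), hJH.measure_pathEvent x, h3,
      ← ENNReal.ofReal_prod_of_nonneg fun k _ => hg0' _,
      ← ENNReal.ofReal_mul (Finset.prod_nonneg fun k _ => hg0' _),
      ← ENNReal.ofReal_mul (mul_nonneg (hπ0' _) (Finset.prod_nonneg fun k _ => hQ _ _))]
    simp only [killedMatrix, Finset.prod_mul_distrib]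
    congr 1
    ring
  rw [← lintegral_indicator (hJH.measurableSet_chain_eq N none), lintegral_congr h1,
    lintegral_finsetSum (f := fun x =>
      (pathEvent J x).indicator fun ω => F x fun q => H q.1 q.2 ω) _ fun x _ =>
      ((hF x).comp hHm).indicator (hJH.measurableSet_pathEvent x)]
  simp_rw [lintegral_indicator (hJH.measurableSet_pathEvent _), h2]
  rw [← ENNReal.ofReal_sum_of_nonneg fun x _ => mul_nonneg (mul_nonneg (hπ0' _)
    (Finset.prod_nonneg fun k _ => hK _ _)) (hf0 (x (Fin.last N))),
    sum_paths_eq_dotProduct_pow_mulVec (killedMatrix g T) f N fun x => x.elim 0 π]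
  simp [dotProduct, Fintype.sum_option]

lemma exists_tendsto_setLIntegral_holdProd (hJH : IsMLMarkovRenewal P a π T J H) [Nonempty ι]
    [IsProbabilityMeasure P] (hT : IsTransientSubIntensity T) (hπ0 : ∀ i, 0 ≤ π i)
    {h : ι → ℝ → ℝ≥0∞} (hh : ∀ i, Measurable (h i)) {g : ι → ℝ} (hg0 : ∀ i, 0 ≤ g i)
    (hg1 : ∀ i, g i ≤ 1)
    (hg : ∀ i, ∫⁻ y, h i y ∂mlMeasure a (-T i i) = ENNReal.ofReal (g i)) :
    ∃ v : ι → ℝ, (∀ i, -T i i * v i = g i * ((T *ᵥ v) i - T i i * v i + exitRates T i)) ∧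
      Tendsto (fun N => ∫⁻ ω in {ω | J N ω = none}, holdProd h J H N ω ∂P) atTop
        (𝓝 (ENNReal.ofReal (π ⬝ᵥ v))) := by
  obtain ⟨v, hv, hlim⟩ := exists_tendsto_killedMatrix_pow hT hg0 hg1
  refine ⟨v, hv, ?_⟩
  simp_rw [hJH.setLIntegral_holdProd hT hπ0 hh hg0 hg]
  exact ENNReal.tendsto_ofReal (tendsto_finsetSum _ fun i _ => (hlim i).const_mul _)

/-- Total mass one comes from being the law of a holding time, with no integration of the density.
-/
lemma isProbabilityMeasure_mlMeasure (hJH : IsMLMarkovRenewal P a π T J H)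
    [IsProbabilityMeasure P] (i : ι) : IsProbabilityMeasure (mlMeasure a (-T i i)) := by
  rw [← hJH.hold_law i 0]
  exact Measure.isProbabilityMeasure_map (hJH.measurable_hold i 0).aemeasurable

/-- Without killing, the first-step equation reads $Tv=T\mathbf 1$, so $v=\mathbf 1$ by
invertibility and the probability of having been absorbed by step $N$ tends to one. -/
lemma ae_exists_chain_eq_none (hJH : IsMLMarkovRenewal P a π T J H) [Nonempty ι]
    [IsProbabilityMeasure P] (hT : IsTransientSubIntensity T) (hπ0 : ∀ i, 0 ≤ π i)
    (hπ1 : ∑ i, π i = 1) : ∀ᵐ ω ∂P, ∃ N, J N ω = none := by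
  obtain ⟨v, hv, hlim⟩ := hJH.exists_tendsto_setLIntegral_holdProd hT hπ0 (h := fun _ _ => 1)
    (g := fun _ => 1) (fun _ => measurable_const) (fun _ => zero_le_one) (fun _ => le_rfl)
    (fun i => by
      have := hJH.isProbabilityMeasure_mlMeasure i
      simp)
  have hv1 : v = 1 := by
    have h1 : (-T) *ᵥ v = (-T) *ᵥ 1 := by
      ext i
      have := hv i
      have he : exitRates T i = -(T *ᵥ 1) i := rfl
      rw [Matrix.neg_mulVec, Matrix.neg_mulVec, Pi.neg_apply, Pi.neg_apply, ← he]
      linarith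
    exact Matrix.mulVec_injective_iff_isUnit.2 hT.minimumPrinciple.isUnit_neg h1
  rw [hv1, dotProduct_one, hπ1, ENNReal.ofReal_one] at hlim
  have h2 : ∀ N, ∫⁻ ω in {ω | J N ω = none}, holdProd (fun _ _ => 1) J H N ω ∂P ≤
      P {ω | ∃ N, J N ω = none} := by
    intro N
    have h3 : ∀ ω, holdProd (fun _ _ => 1) J H N ω = 1 := fun ω =>
      Finset.prod_eq_one fun k _ => by rcases J k ω with _ | i <;> rfl
    simp only [h3, setLIntegral_one]
    exact measure_mono fun ω hω => ⟨N, hω⟩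
  have h4 : 1 ≤ P {ω | ∃ N, J N ω = none} := le_of_tendsto' hlim h2
  have hm : MeasurableSet {ω | ∃ N, J N ω = none} := by
    rw [Set.ofPred_exists]
    exact MeasurableSet.iUnion fun N => hJH.measurableSet_chain_eq N none
  rw [ae_iff]
  exact (prob_compl_eq_zero_iff hm).2 (le_antisymm prob_le_one h4)

lemma ae_chain_absorbed (hJH : IsMLMarkovRenewal P a π T J H) :
    ∀ᵐ ω ∂P, ∀ m n, m ≤ n → J m ω = none → J n ω = none := by
  have hstep : ∀ n, ∀ᵐ ω ∂P, J n ω = none → J (n + 1) ω = none := by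
    intro n
    have h1 : ∀ x : Fin (n + 2) → Option ι, ∀ᵐ ω ∂P, ω ∈ pathEvent J x →
        (J n ω = none → J (n + 1) ω = none) := by
      intro x
      by_cases hx : x (Fin.last n).castSucc = none ∧ x (Fin.last n).succ ≠ none
      · have h0 : P (pathEvent J x) = 0 := by
          obtain ⟨i, hi⟩ := Option.ne_none_iff_exists'.1 hx.2
          rw [hJH.measure_pathEvent, Finset.prod_eq_zero (Finset.mem_univ (Fin.last n)), mul_zero,
            ENNReal.ofReal_zero]
          rw [hx.1, hi]
          rfl
        filter_upwards [measure_eq_zero_iff_ae_notMem.1 h0] with ω hω h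
        exact absurd h hω
      · refine ae_of_all _ fun ω hω hn => ?_
        have h2 := hω (Fin.last n).castSucc
        have h3 := hω (Fin.last n).succ
        simp only [Fin.val_castSucc, Fin.val_last, Fin.val_succ] at h2 h3
        rw [hn] at h2
        by_contra h
        exact hx ⟨h2.symm, fun h4 => h (h3.trans h4)⟩
    filter_upwards [ae_all_iff.2 h1] with ω hω
    exact hω (fun k => J k ω) fun k => rfl
  filter_upwards [ae_all_iff.2 hstep] with ω hω m n hmn hm
  induction n, hmn using Nat.le_induction with
  | base => exact hm
  | succ n _ ih => exact hω n ih

lemma ae_hold_pos (hJH : IsMLMarkovRenewal P a π T J H) : ∀ᵐ ω ∂P, ∀ i n, 0 < H i n ω := by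
  refine ae_all_iff.2 fun i => ae_all_iff.2 fun n => ?_
  have := ae_mlMeasure_pos a (-T i i)
  rw [← hJH.hold_law i n] at this
  exact ae_of_ae_map (hJH.measurable_hold i n).aemeasurable this

/-- The expectation of a functional of the holding times up to absorption. -/
theorem exists_lintegral_eq (hJH : IsMLMarkovRenewal P a π T J H) [Nonempty ι]
    [IsProbabilityMeasure P] (hT : IsTransientSubIntensity T) (hπ0 : ∀ i, 0 ≤ π i)
    (hπ1 : ∑ i, π i = 1)
    {h : ι → ℝ → ℝ≥0∞} (hh : ∀ i, Measurable (h i)) {g : ι → ℝ} (hg0 : ∀ i, 0 ≤ g i)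
    (hg1 : ∀ i, g i ≤ 1)
    (hg : ∀ i, ∫⁻ y, h i y ∂mlMeasure a (-T i i) = ENNReal.ofReal (g i))
    {f : Ω → ℝ≥0∞} (hfm : AEMeasurable f P)
    (hf : ∀ᵐ ω ∂P, ∀ N, J N ω = none → f ω = holdProd h J H N ω) :
    ∃ v : ι → ℝ, (∀ i, -T i i * v i = g i * ((T *ᵥ v) i - T i i * v i + exitRates T i)) ∧
      ∫⁻ ω, f ω ∂P = ENNReal.ofReal (π ⬝ᵥ v) := by
  obtain ⟨v, hv, hlim⟩ := hJH.exists_tendsto_setLIntegral_holdProd hT hπ0 hh hg0 hg1 hg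
  refine ⟨v, hv, tendsto_nhds_unique ?_ hlim⟩
  have h1 : ∀ N, ∫⁻ ω in {ω | J N ω = none}, holdProd h J H N ω ∂P =
      ∫⁻ ω, {ω | J N ω = none}.indicator f ω ∂P := by
    intro N
    rw [lintegral_indicator (hJH.measurableSet_chain_eq N none)]
    refine setLIntegral_congr_fun_ae (hJH.measurableSet_chain_eq N none) ?_
    filter_upwards [hf] with ω hω hN using (hω N hN).symm
  simp_rw [h1]
  -- Absorption is permanent and almost sure, so the indicators of $\{J_N=$ `none`$\}$ increase to
  -- one almost surely.
  refine lintegral_tendsto_of_tendsto_of_monotone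
    (fun N => hfm.indicator (hJH.measurableSet_chain_eq N none)) ?_ ?_
  · filter_upwards [hJH.ae_chain_absorbed] with ω hω m n hmn
    beta_reduce
    by_cases hm : J m ω = none
    · rw [Set.indicator_of_mem (show ω ∈ {ω | J m ω = none} from hm),
        Set.indicator_of_mem (show ω ∈ {ω | J n ω = none} from hω m n hmn hm)]
    · rw [Set.indicator_of_notMem (show ω ∉ {ω | J m ω = none} from hm)]
      exact zero_le
  · filter_upwards [hJH.ae_chain_absorbed, hJH.ae_exists_chain_eq_none hT hπ0 hπ1]
      with ω hω ⟨m, hm⟩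
    refine tendsto_const_nhds.congr' ?_
    filter_upwards [eventually_ge_atTop m] with n hn
    rw [Set.indicator_of_mem (show ω ∈ {ω | J n ω = none} from hω m n hn hm)]

end IsMLMarkovRenewal

end PathLaw

/-! ### The reward along a trajectory -/

section Trajectory

variable {ι Ω : Type*} {J : ℕ → Ω → Option ι} {H : ι → ℕ → Ω → ℝ} {ω : Ω}

lemma jumpTime_succ (n : ℕ) :
    jumpTime J H (n + 1) ω = jumpTime J H n ω + sojourn J H n ω :=
  Finset.sum_range_succ _ _

lemma monotone_jumpTime : Monotone fun n => jumpTime J H n ω :=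
  monotone_nat_of_le_succ fun n => by
    rw [jumpTime_succ]
    exact le_self_add

lemma semiMarkov_eq {n : ℕ} {t : ℝ} (h1 : jumpTime J H n ω ≤ ENNReal.ofReal t)
    (h2 : ENNReal.ofReal t < jumpTime J H (n + 1) ω) : semiMarkov J H t ω = J n ω := by
  classical
  have h : ∃ n : ℕ, jumpTime J H n ω ≤ ENNReal.ofReal t ∧
      ENNReal.ofReal t < jumpTime J H (n + 1) ω := ⟨n, h1, h2⟩
  rw [semiMarkov, dif_pos h]
  congr 1
  rw [Nat.find_eq_iff]
  refine ⟨⟨h1, h2⟩, fun m hm hm' => ?_⟩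
  exact absurd (hm'.2.trans_le (monotone_jumpTime (Nat.succ_le_of_lt hm))) (not_lt.2 h1)

lemma exists_jumpTime_le_lt {n : ℕ} {s : ℝ≥0∞} (h : s < jumpTime J H n ω) :
    ∃ m < n, jumpTime J H m ω ≤ s ∧ s < jumpTime J H (m + 1) ω := by
  induction n with
  | zero => simp [jumpTime] at h
  | succ n ih =>
    by_cases hn : s < jumpTime J H n ω
    · obtain ⟨m, hm, hm'⟩ := ih hn
      exact ⟨m, by omega, hm'⟩
    · exact ⟨n, n.lt_succ_self, not_lt.1 hn, h⟩

lemma jumpTime_ne_top {n : ℕ} (h : ∀ k < n, J k ω ≠ none) : jumpTime J H n ω ≠ ⊤ := by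
  refine ENNReal.sum_ne_top.2 fun k hk => ?_
  obtain ⟨i, hi⟩ := Option.ne_none_iff_exists'.1 (h k (Finset.mem_range.1 hk))
  simp [sojourn, hi]

lemma absorptionTime_eq {n : ℕ} (h : ∀ k < n, J k ω ≠ none) (hn : J n ω = none) :
    absorptionTime (semiMarkov J H) ω = jumpTime J H n ω := by
  have htop := jumpTime_ne_top (H := H) h
  refine le_antisymm ?_ ?_
  · have h1 : ENNReal.ofReal (jumpTime J H n ω).toReal = jumpTime J H n ω :=
      ENNReal.ofReal_toReal htop
    refine iInf_le_of_le (jumpTime J H n ω).toReal (iInf_le_of_le ENNReal.toReal_nonneg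
      (iInf_le_of_le ?_ h1.le))
    rw [semiMarkov_eq (n := n) h1.ge, hn]
    rw [h1, jumpTime_succ, sojourn, hn]
    simpa using htop.lt_top
  · refine le_iInf fun t => le_iInf fun _ => le_iInf fun ht => ?_
    by_contra! hlt
    obtain ⟨m, hm, h1, h2⟩ := exists_jumpTime_le_lt hlt
    rw [semiMarkov_eq h1 h2] at ht
    exact h m hm ht

variable [Fintype ι]

open Classical in
-- The process is constant on $[S_n,S_{n+1})$, an interval of length equal to the holding time;
-- induction appends one such interval.
lemma lintegral_reward_eq (r : ι → ℝ) (hr0 : ∀ i, 0 ≤ r i) (hpos : ∀ i n, 0 < H i n ω) {n : ℕ}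
    (h : ∀ k < n, J k ω ≠ none) :
    ∫⁻ t in {t : ℝ | 0 ≤ t ∧ ENNReal.ofReal t < jumpTime J H n ω},
      ∑ i, (if semiMarkov J H t ω = some i then ENNReal.ofReal (r i) else 0) =
    ∑ k ∈ Finset.range n, (J k ω).elim 0 fun i => ENNReal.ofReal (r i * H i k ω) := by
  induction n with
  | zero => simp [jumpTime]
  | succ n ih =>
    have hlt : ∀ c : ℝ≥0∞, MeasurableSet {t : ℝ | 0 ≤ t ∧ ENNReal.ofReal t < c} := fun c =>
      measurableSet_Ici.inter (ENNReal.measurable_ofReal measurableSet_Iio)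
    have hle : jumpTime J H n ω ≤ jumpTime J H (n + 1) ω := monotone_jumpTime n.le_succ
    have hunion : {t : ℝ | 0 ≤ t ∧ ENNReal.ofReal t < jumpTime J H (n + 1) ω} =
        {t : ℝ | 0 ≤ t ∧ ENNReal.ofReal t < jumpTime J H n ω} ∪
        {t : ℝ | 0 ≤ t ∧ jumpTime J H n ω ≤ ENNReal.ofReal t ∧
          ENNReal.ofReal t < jumpTime J H (n + 1) ω} := by
      ext t
      simp only [Set.mem_ofPred_eq, Set.mem_union]
      constructor
      · rintro ⟨h1, h2⟩
        rcases lt_or_ge (ENNReal.ofReal t) (jumpTime J H n ω) with h3 | h3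
        · exact Or.inl ⟨h1, h3⟩
        · exact Or.inr ⟨h1, h3, h2⟩
      · rintro (⟨h1, h2⟩ | ⟨h1, _, h2⟩)
        · exact ⟨h1, h2.trans_le hle⟩
        · exact ⟨h1, h2⟩
    have hm : MeasurableSet {t : ℝ | 0 ≤ t ∧ jumpTime J H n ω ≤ ENNReal.ofReal t ∧
        ENNReal.ofReal t < jumpTime J H (n + 1) ω} :=
      measurableSet_Ici.inter ((ENNReal.measurable_ofReal measurableSet_Ici).inter
        (ENNReal.measurable_ofReal measurableSet_Iio))
    rw [hunion, lintegral_union hm, ih fun k hk => h k (by omega), Finset.sum_range_succ]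
    · congr 1
      obtain ⟨i, hi⟩ := Option.ne_none_iff_exists'.1 (h n n.lt_succ_self)
      have htop := jumpTime_ne_top (H := H) (ω := ω) fun k (hk : k < n) => h k (by omega)
      set s := (jumpTime J H n ω).toReal with hs
      have hs0 : 0 ≤ s := ENNReal.toReal_nonneg
      have h1 : jumpTime J H n ω = ENNReal.ofReal s := (ENNReal.ofReal_toReal htop).symm
      have h2 : jumpTime J H (n + 1) ω = ENNReal.ofReal (s + H i n ω) := by
        rw [jumpTime_succ, h1, sojourn, hi, Option.elim_some,
          ENNReal.ofReal_add hs0 (hpos i n).le]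
      have h3 : {t : ℝ | 0 ≤ t ∧ jumpTime J H n ω ≤ ENNReal.ofReal t ∧
          ENNReal.ofReal t < jumpTime J H (n + 1) ω} = Set.Ico s (s + H i n ω) := by
        ext t
        rw [h1, h2, Set.mem_ofPred_eq, Set.mem_Ico,
          ENNReal.ofReal_lt_ofReal_iff (add_pos_of_nonneg_of_pos hs0 (hpos i n))]
        constructor
        · rintro ⟨h4, h5, h6⟩
          exact ⟨(ENNReal.ofReal_le_ofReal_iff h4).1 h5, h6⟩
        · rintro ⟨h4, h5⟩
          exact ⟨hs0.trans h4, ENNReal.ofReal_le_ofReal h4, h5⟩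
      rw [setLIntegral_congr_fun (g := fun _ => ENNReal.ofReal (r i)) hm, setLIntegral_const, h3,
        Real.volume_Ico, hi, Option.elim_some, ENNReal.ofReal_mul (hr0 i), add_sub_cancel_left]
      rintro t ⟨_, h4, h5⟩
      simp only [semiMarkov_eq h4 h5, hi, Option.some_inj, Finset.sum_ite_eq, Finset.mem_univ,
        if_true]
    · rw [Set.disjoint_left]
      rintro t ⟨_, h1⟩ ⟨_, h2, _⟩
      exact absurd h1 (not_lt.2 h2)

/-- The total reward is the sum of the rewards collected in the visited states. -/
theorem totalReward_eq (r : ι → ℝ) (hr0 : ∀ i, 0 ≤ r i) (hpos : ∀ i n, 0 < H i n ω) {N : ℕ}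
    (hN : J N ω = none) (habs : ∀ m n, m ≤ n → J m ω = none → J n ω = none) :
    totalReward r (semiMarkov J H) ω =
      ∑ k ∈ Finset.range N, (J k ω).elim 0 fun i => ENNReal.ofReal (r i * H i k ω) := by
  classical
  have hex : ∃ n, J n ω = none := ⟨N, hN⟩
  have hlt : ∀ k < Nat.find hex, J k ω ≠ none := fun k hk => Nat.find_min hex hk
  rw [totalReward, absorptionTime_eq hlt (Nat.find_spec hex), lintegral_reward_eq r hr0 hpos hlt]
  -- Visits after absorption contribute zero, so any index at or after absorption gives the same
  -- sum.
  refine Finset.sum_subset (Finset.range_subset_range.2 (Nat.find_min' hex hN)) fun k _ hk => ?_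
  rw [habs _ k (not_lt.1 fun h => hk (Finset.mem_range.2 h)) (Nat.find_spec hex)]
  rfl

end Trajectory

/-! ### Absolute continuity, Laplace transform and atom of the reward -/

section RewardLaw

open Filter Topology

variable {ι : Type*} [Fintype ι] [DecidableEq ι] {Ω : Type*} [MeasurableSpace Ω] {P : Measure Ω}
  {a : ℝ} {π : ι → ℝ} {T : Matrix ι ι ℝ} {J : ℕ → Ω → Option ι} {H : ι → ℕ → Ω → ℝ} {r : ι → ℝ}

lemma map_mul_left_mlMeasure_absolutelyContinuous (l : ℝ) {c : ℝ} (hc : 0 < c) :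
    (mlMeasure a l).map (fun y => c * y) ≪ volume := by
  refine ((mlMeasure_absolutelyContinuous a l).map (measurable_const_mul c)).trans ?_
  rw [Real.map_volume_mul_left hc.ne']
  exact Measure.smul_absolutelyContinuous

namespace IsMLMarkovRenewal

/-- The reward along a fixed path has no mass on null sets without zero. -/
lemma measure_sum_hold_mem_eq_zero (hJH : IsMLMarkovRenewal P a π T J H) [Nonempty ι]
    [IsProbabilityMeasure P] (hr0 : ∀ i, 0 ≤ r i) {N : ℕ} (x : Fin N → Option ι) {A : Set ℝ}
    (hA : MeasurableSet A) (hA0 : volume A = 0) (h0 : (0 : ℝ) ∉ A) (s : Finset (Fin N)) :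
    P {ω | ∑ k ∈ s, ((x k).elim 0 fun i => r i * H i k ω) ∈ A} = 0 := by
  have hm : ∀ k : Fin N, Measurable fun ω => (x k).elim 0 fun i => r i * H i k ω := fun k =>
    hJH.measurable_hold_elim k (x k) 0 fun i => measurable_const_mul (r i)
  have hind := hJH.iIndepFun_hold x (0 : ℝ) fun i => measurable_const_mul (r i)
  induction s using Finset.induction_on with
  | empty => simp [h0]
  | insert k s hk ih =>
    simp only [Finset.sum_insert hk]
    -- A summand from `none` or a zero-reward phase vanishes and can be dropped. Any other is
    -- absolutely continuous and independent of the rest, so convolution with it removes all mass on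
    -- null sets. The empty sum is $0\notin A$.
    by_cases hzero : ∀ ω, (x k).elim 0 (fun i => r i * H i k ω) = 0
    · simpa only [hzero, zero_add] using ih
    · obtain ⟨i, hi⟩ : ∃ i, x k = some i := by
        rw [← Option.ne_none_iff_exists']
        exact fun h => hzero fun ω => by rw [h]; rfl
      have hri : 0 < r i := (hr0 i).lt_of_ne fun h => hzero fun ω => by simp [hi, ← h]
      have hac : P.map (fun ω => (x k).elim 0 fun i => r i * H i k ω) ≪ volume := by
        have h1 : (fun ω => (x k).elim 0 fun i => r i * H i k ω) =
            (fun y => r i * y) ∘ H i k := by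
          ext ω; rw [hi]; rfl
        rw [h1, ← Measure.map_map (measurable_const_mul _) (hJH.measurable_hold i k),
          hJH.hold_law]
        exact map_mul_left_mlMeasure_absolutelyContinuous _ hri
      have hsum : Measurable (∑ j ∈ s, fun ω => (x j).elim 0 fun i => r i * H i j ω) := by
        convert Finset.measurable_sum s fun j _ => hm j using 1
        ext ω
        simp [Finset.sum_apply]
      have hconv := (hind.indepFun_finsetSum_of_notMem hm hk).map_add_eq_map_conv_map hsum (hm k)
      have : IsProbabilityMeasure (P.map (fun ω => (x k).elim 0 fun i => r i * H i k ω)) :=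
        Measure.isProbabilityMeasure_map (hm k).aemeasurable
      have h2 := Measure.conv_absolutelyContinuous (μ := P.map
        (∑ j ∈ s, fun ω => (x j).elim 0 fun i => r i * H i j ω)) hac hA0
      rw [← hconv, Measure.map_apply (hsum.add (hm k)) hA] at h2
      convert h2 using 2
      ext ω
      simp [Finset.sum_apply, add_comm]

/-- The reward is almost surely equal to the series over all visits, which is measurable and whose
terms vanish after absorption. -/
lemma aemeasurable_totalReward (hJH : IsMLMarkovRenewal P a π T J H) [Nonempty ι]
    [IsProbabilityMeasure P] (hT : IsTransientSubIntensity T) (hπ0 : ∀ i, 0 ≤ π i)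
    (hπ1 : ∑ i, π i = 1) (hr0 : ∀ i, 0 ≤ r i) :
    AEMeasurable (fun ω => totalReward r (semiMarkov J H) ω) P := by
  have hm : Measurable fun ω => ∑' k, (J k ω).elim 0 fun i => ENNReal.ofReal (r i * H i k ω) := by
    refine Measurable.tsum fun k => ?_
    have h1 : (fun ω => (J k ω).elim 0 fun i => ENNReal.ofReal (r i * H i k ω)) = fun ω =>
        ∑ i, {ω | J k ω = some i}.indicator (fun ω => ENNReal.ofReal (r i * H i k ω)) ω := by
      ext ω
      rcases hk : J k ω with _ | j
      · simp [Set.indicator, hk]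
      · simp [Set.indicator, hk]
    rw [h1]
    exact Finset.measurable_sum _ fun i _ => (((hJH.measurable_hold i k).const_mul
      (r i)).ennreal_ofReal).indicator (hJH.measurableSet_chain_eq k (some i))
  refine ⟨_, hm, ?_⟩
  filter_upwards [hJH.ae_hold_pos, hJH.ae_chain_absorbed,
    hJH.ae_exists_chain_eq_none hT hπ0 hπ1] with ω hpos habs ⟨N, hN⟩
  rw [totalReward_eq r hr0 hpos hN habs]
  refine (tsum_eq_sum fun k hk => ?_).symm
  rw [habs N k (not_lt.1 fun h => hk (Finset.mem_range.2 h)) hN]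
  rfl

lemma ae_totalReward_lt_top (hJH : IsMLMarkovRenewal P a π T J H) [Nonempty ι]
    [IsProbabilityMeasure P] (hT : IsTransientSubIntensity T) (hπ0 : ∀ i, 0 ≤ π i)
    (hπ1 : ∑ i, π i = 1) (hr0 : ∀ i, 0 ≤ r i) :
    ∀ᵐ ω ∂P, totalReward r (semiMarkov J H) ω < ⊤ := by
  filter_upwards [hJH.ae_hold_pos, hJH.ae_chain_absorbed,
    hJH.ae_exists_chain_eq_none hT hπ0 hπ1] with ω hpos habs ⟨N, hN⟩
  rw [totalReward_eq r hr0 hpos hN habs]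
  refine ENNReal.sum_lt_top.2 fun k _ => ?_
  rcases J k ω with _ | i
  · exact ENNReal.zero_lt_top
  · exact ENNReal.ofReal_lt_top

lemma ae_toReal_totalReward_eq (hJH : IsMLMarkovRenewal P a π T J H) (hr0 : ∀ i, 0 ≤ r i) :
    ∀ᵐ ω ∂P, ∀ N, J N ω = none → (totalReward r (semiMarkov J H) ω).toReal =
      ∑ k ∈ Finset.range N, (J k ω).elim 0 fun i => r i * H i k ω := by
  filter_upwards [hJH.ae_hold_pos, hJH.ae_chain_absorbed] with ω hpos habs N hN
  rw [totalReward_eq r hr0 hpos hN habs, ENNReal.toReal_sum]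
  · refine Finset.sum_congr rfl fun k _ => ?_
    rcases J k ω with _ | i
    · rfl
    · exact ENNReal.toReal_ofReal (mul_nonneg (hr0 i) (hpos i k).le)
  · intro k _
    rcases J k ω with _ | i
    · exact ENNReal.zero_ne_top
    · exact ENNReal.ofReal_ne_top

/-- The law of the reward has no mass on null sets without zero. -/
lemma measure_totalReward_mem_eq_zero (hJH : IsMLMarkovRenewal P a π T J H) [Nonempty ι]
    [IsProbabilityMeasure P] (hT : IsTransientSubIntensity T) (hπ0 : ∀ i, 0 ≤ π i)
    (hπ1 : ∑ i, π i = 1) (hr0 : ∀ i, 0 ≤ r i) {A : Set ℝ}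
    (hA : MeasurableSet A) (hA0 : volume A = 0) (h0 : (0 : ℝ) ∉ A) :
    P {ω | (totalReward r (semiMarkov J H) ω).toReal ∈ A} = 0 := by
  have h1 : ∀ᵐ ω ∂P, ∀ (N : ℕ) (x : Fin N → Option ι),
      ∑ k, ((x k).elim 0 fun i => r i * H i k ω) ∉ A :=
    ae_all_iff.2 fun N => ae_all_iff.2 fun x => measure_eq_zero_iff_ae_notMem.1
      (hJH.measure_sum_hold_mem_eq_zero hr0 x hA hA0 h0 Finset.univ)
  refine measure_eq_zero_iff_ae_notMem.2 ?_
  filter_upwards [h1, hJH.ae_toReal_totalReward_eq hr0, hJH.ae_exists_chain_eq_none hT hπ0 hπ1]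
    with ω h2 h3 ⟨N, hN⟩ hmem
  have h4 : (totalReward r (semiMarkov J H) ω).toReal ∈ A := hmem
  rw [h3 N hN, Finset.sum_range] at h4
  exact h2 N (fun k => J k ω) h4

/-- The Laplace transform of the reward. -/
lemma integral_exp_totalReward (hJH : IsMLMarkovRenewal P a π T J H) [Nonempty ι]
    [IsProbabilityMeasure P] (ha0 : 0 < a) (ha1 : a ≤ 1) (hT : IsTransientSubIntensity T)
    (hπ0 : ∀ i, 0 ≤ π i) (hπ1 : ∑ i, π i = 1) (hr0 : ∀ i, 0 ≤ r i) {u : ℝ} (hu : 0 ≤ u) :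
    ∫ ω, Real.exp (-u * (totalReward r (semiMarkov J H) ω).toReal) ∂P =
      rewardInit π T r ⬝ᵥ
        (((u ^ a) • (1 : Matrix (PosPhase r) (PosPhase r) ℝ) - rewardSubIntensity a T r)⁻¹ *ᵥ
          exitRates (rewardSubIntensity a T r)) + (1 - ∑ i, rewardInit π T r i) := by
  have hs : ∀ i, 0 ≤ (u * r i) ^ a := fun i => Real.rpow_nonneg (mul_nonneg hu (hr0 i)) a
  have hl : ∀ i, 0 < -T i i := fun i => neg_pos.2 (hT.diag_neg i)
  have hY := (hJH.aemeasurable_totalReward hT hπ0 hπ1 hr0).ennreal_toReal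
  obtain ⟨v, hv, hint⟩ := hJH.exists_lintegral_eq hT hπ0 hπ1
    (h := fun i y => ENNReal.ofReal (Real.exp (-(u * r i * y))))
    (g := fun i => -T i i / (-T i i + (u * r i) ^ a))
    (f := fun ω => ENNReal.ofReal (Real.exp (-u * (totalReward r (semiMarkov J H) ω).toReal)))
    (fun i => by fun_prop) (fun i => div_nonneg (hl i).le (add_nonneg (hl i).le (hs i)))
    (fun i => div_le_one_of_le₀ (by linarith [hs i]) (add_nonneg (hl i).le (hs i)))
    (fun i => by
      have := hJH.isProbabilityMeasure_mlMeasure i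
      rw [← integral_exp_mlMeasure ha0 ha1 (hl i) (mul_nonneg hu (hr0 i)),
        ofReal_integral_eq_lintegral_ofReal _ (ae_of_all _ fun _ => (Real.exp_pos _).le)]
      refine (integrable_const (1 : ℝ)).mono' (by fun_prop) ?_
      filter_upwards [ae_mlMeasure_pos a (-T i i)] with y hy
      rw [Real.norm_of_nonneg (Real.exp_pos _).le, Real.exp_le_one_iff, neg_nonpos]
      exact mul_nonneg (mul_nonneg hu (hr0 i)) hy.le)
    ((hY.const_mul (-u)).exp.ennreal_ofReal)
    (by
      filter_upwards [hJH.ae_toReal_totalReward_eq hr0] with ω hω N hN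
      rw [hω N hN, Finset.mul_sum, Real.exp_sum,
        ENNReal.ofReal_prod_of_nonneg fun _ _ => (Real.exp_pos _).le]
      refine Finset.prod_congr rfl fun k _ => ?_
      rcases J k ω with _ | i
      · simp
      · simp only [Option.elim_some]
        ring_nf)
  have hv' : ∀ i, (u * r i) ^ a * v i - (T *ᵥ v) i = exitRates T i := by
    intro i
    have h1 := hv i
    have h2 : -T i i + (u * r i) ^ a ≠ 0 := (add_pos_of_pos_of_nonneg (hl i) (hs i)).ne'
    have h3 : T i i ≠ 0 := (hT.diag_neg i).ne
    rw [div_mul_eq_mul_div, eq_div_iff h2, mul_assoc] at h1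
    have h4 := mul_left_cancel₀ (hl i).ne' h1
    linarith
  -- Where $v_i<0$, $(Tv)_i=(ur_i)^av_i-t_i\le 0$, so the minimum principle applies. The sign is
  -- needed to undo `ENNReal.ofReal`.
  have hv0 : ∀ i, 0 ≤ v i := hT.minimumPrinciple v fun i hi => by
    nlinarith [hv' i, hs i, hT.exit_nonneg i]
  have hz : ∀ i, r i = 0 → -(T *ᵥ v) i = exitRates T i := fun i hi => by
    rw [← hv' i, hi, mul_zero, Real.zero_rpow ha0.ne']
    ring
  have hπv : 0 ≤ π ⬝ᵥ v := Finset.sum_nonneg fun i _ => mul_nonneg (hπ0 i) (hv0 i)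
  rw [integral_eq_lintegral_of_nonneg_ae (ae_of_all _ fun _ => (Real.exp_pos _).le)
    (hY.const_mul (-u)).exp.aestronglyMeasurable, hint,
    ENNReal.toReal_ofReal hπv,
    dotProduct_eq_rewardInit_dotProduct hr0 hT.minimumPrinciple hπ1 hz,
    eq_inv_mulVec_exitRates hr0 hT.minimumPrinciple ha0 hu hv']

/-- The atom of the reward at zero. -/
lemma measure_totalReward_eq_zero (hJH : IsMLMarkovRenewal P a π T J H) [Nonempty ι]
    [IsProbabilityMeasure P] (hT : IsTransientSubIntensity T)
    (hπ0 : ∀ i, 0 ≤ π i) (hπ1 : ∑ i, π i = 1) (hr0 : ∀ i, 0 ≤ r i) :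
    P.map (fun ω => (totalReward r (semiMarkov J H) ω).toReal) {0} =
      ENNReal.ofReal (1 - ∑ i, rewardInit π T r i) := by
  have hY := (hJH.aemeasurable_totalReward hT hπ0 hπ1 hr0).ennreal_toReal
  have hind : Measurable (({0} : Set ℝ).indicator (1 : ℝ → ℝ≥0∞)) :=
    measurable_one.indicator (measurableSet_singleton 0)
  have hI0 : ({0} : Set ℝ).indicator (1 : ℝ → ℝ≥0∞) 0 = 1 := by simp
  have hI : ∀ {y : ℝ}, y ≠ 0 → ({0} : Set ℝ).indicator (1 : ℝ → ℝ≥0∞) y = 0 := fun hy => by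
    simp [hy]
  obtain ⟨v, hv, hint⟩ := hJH.exists_lintegral_eq hT hπ0 hπ1
    (h := fun i y => ({0} : Set ℝ).indicator (1 : ℝ → ℝ≥0∞) (r i * y))
    -- Holding times are positive, so the reward is zero exactly when no phase of $E_+$ is visited:
    -- the chain is killed upon visiting $E_+$.
    (g := fun i => if r i = 0 then 1 else 0)
    (f := fun ω => ({0} : Set ℝ).indicator (1 : ℝ → ℝ≥0∞)
      (totalReward r (semiMarkov J H) ω).toReal)
    (fun i => hind.comp (measurable_const_mul (r i)))
    (fun i => by split_ifs <;> norm_num) (fun i => by split_ifs <;> norm_num)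
    (fun i => by
      have := hJH.isProbabilityMeasure_mlMeasure i
      by_cases hi : r i = 0
      · simp [hi]
      · simp only [hi, if_false, ENNReal.ofReal_zero]
        refine lintegral_eq_zero_of_ae_eq_zero ?_
        filter_upwards [ae_mlMeasure_pos a (-T i i)] with y hy
        exact hI (mul_ne_zero hi hy.ne'))
    (hind.comp_aemeasurable hY)
    (by
      filter_upwards [hJH.ae_toReal_totalReward_eq hr0, hJH.ae_hold_pos] with ω hω hpos N hN
      have hnn : ∀ k ∈ Finset.range N, 0 ≤ (J k ω).elim 0 fun i => r i * H i k ω := by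
        intro k _
        rcases J k ω with _ | i
        · exact le_rfl
        · exact mul_nonneg (hr0 i) (hpos i k).le
      rw [hω N hN, holdProd]
      by_cases hz : ∑ k ∈ Finset.range N, ((J k ω).elim 0 fun i => r i * H i k ω) = 0
      · rw [hz, hI0, Finset.prod_eq_one]
        intro k hk
        have h1 := (Finset.sum_eq_zero_iff_of_nonneg hnn).1 hz k hk
        rcases hJ : J k ω with _ | i
        · rfl
        · rw [hJ, Option.elim_some] at h1
          rw [Option.elim_some, h1, hI0]
      · rw [hI hz]
        obtain ⟨k, hk, hne⟩ := Finset.exists_ne_zero_of_sum_ne_zero hz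
        symm
        refine Finset.prod_eq_zero hk ?_
        rcases hJ : J k ω with _ | i
        · rw [hJ] at hne
          exact absurd rfl hne
        · rw [hJ, Option.elim_some] at hne
          rw [Option.elim_some, hI hne])
  have hz : ∀ i, r i = 0 → -(T *ᵥ v) i = exitRates T i := fun i hi => by
    have := hv i
    simp only [hi, if_true] at this
    linarith
  have hp : (fun i : PosPhase r => v i) = 0 := by
    ext i
    have := hv i
    simp only [i.2.ne', if_false, zero_mul] at this
    exact (mul_eq_zero.1 this).resolve_left (neg_pos.2 (hT.diag_neg i)).ne'
  rw [dotProduct_eq_rewardInit_dotProduct hr0 hT.minimumPrinciple hπ1 hz, hp, dotProduct_zero,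
    zero_add] at hint
  rw [← hint, ← lintegral_indicator_one (measurableSet_singleton 0),
    lintegral_map' hind.aemeasurable hY]

end IsMLMarkovRenewal

end RewardLaw

end

/-! ### Assembly: the phase-type part is the law of the reward off zero -/

theorem mainTheorem5 {ι : Type*} [Fintype ι] [DecidableEq ι]
    {Ω : Type*} [MeasurableSpace Ω] (P : Measure Ω) [IsProbabilityMeasure P]
    (a : ℝ) (ha0 : 0 < a) (ha1 : a ≤ 1)
    (π : ι → ℝ) (hπ0 : ∀ i, 0 ≤ π i) (hπ1 : ∑ i, π i = 1)
    (T : Matrix ι ι ℝ) (hT : IsTransientSubIntensity T)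
    (J : ℕ → Ω → Option ι) (H : ι → ℕ → Ω → ℝ) (hJH : IsMLMarkovRenewal P a π T J H)
    (r : ι → ℝ) (hr0 : ∀ i, 0 ≤ r i) (hr : r ≠ 0) :
    IsUnit (-blockZZ r T) ∧
    (∀ᵐ ω ∂P, totalReward r (semiMarkov J H) ω < ⊤) ∧
    ∃ μ : Measure ℝ,
      IsFracPhaseType a (rewardInit π T r) (rewardSubIntensity a T r) μ ∧
      μ ≪ volume ∧
      P.map (fun ω => (totalReward r (semiMarkov J H) ω).toReal)
        = μ + ENNReal.ofReal (1 - ∑ i, rewardInit π T r i) • Measure.dirac 0 := by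
  have : Nonempty ι := by
    by_contra h
    rw [not_nonempty_iff] at h
    simp at hπ1
  have hMP := hT.minimumPrinciple
  have hY := (hJH.aemeasurable_totalReward hT hπ0 hπ1 hr0).ennreal_toReal
  set ν := P.map (fun ω => (totalReward r (semiMarkov J H) ω).toReal) with hν
  have : IsProbabilityMeasure ν := Measure.isProbabilityMeasure_map hY
  have hdefect : 0 ≤ 1 - ∑ i, rewardInit π T r i := by
    rw [one_sub_sum_rewardInit hr0 hMP hπ1]
    exact Finset.sum_nonneg fun i _ => mul_nonneg (hπ0 i) (zeroPhaseExit_nonneg hr0 hT i)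
  have hsplit : ν = ν.restrict {0}ᶜ +
      ENNReal.ofReal (1 - ∑ i, rewardInit π T r i) • Measure.dirac 0 := by
    rw [← hJH.measure_totalReward_eq_zero hT hπ0 hπ1 hr0, ← hν, ← Measure.restrict_singleton,
      add_comm, Measure.restrict_add_restrict_compl (measurableSet_singleton 0)]
  have hnn : ν (Set.Iio 0) = 0 := by
    rw [hν, Measure.map_apply_of_aemeasurable hY measurableSet_Iio]
    convert measure_empty (μ := P) using 2
    ext ω
    simp
  refine ⟨(hMP.blockZZ hr0).isUnit_neg, hJH.ae_totalReward_lt_top hT hπ0 hπ1 hr0,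
    ν.restrict {0}ᶜ, ⟨rewardInit_nonneg hr0 hT hπ0, by linarith,
      hT.rewardSubIntensity hr0 a,
      fun u hu => (hMP.rewardSubIntensity hr0 a).isUnit_smul_one_sub (Real.rpow_nonneg hu a),
      inferInstance, Measure.absolutelyContinuous_of_le Measure.restrict_le_self hnn,
      fun u hu => ?_⟩, ?_, hsplit⟩
  -- The transform of the full law is known; subtracting the constant contribution of the atom
  -- leaves that of the restriction.
  · have hint : Integrable (fun x => Real.exp (-u * x)) ν := by
      refine (integrable_const (1 : ℝ)).mono' (by fun_prop) ?_
      filter_upwards [measure_eq_zero_iff_ae_notMem.1 hnn] with x hx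
      rw [Real.norm_of_nonneg (Real.exp_pos _).le, Real.exp_le_one_iff]
      have : 0 ≤ x := not_lt.1 hx
      nlinarith
    have h1 := hJH.integral_exp_totalReward ha0 ha1 hT hπ0 hπ1 hr0 hu
    rw [← integral_map (f := fun x => Real.exp (-u * x)) hY (by fun_prop), ← hν] at h1
    have h2 : ∫ x, Real.exp (-u * x) ∂ν = ∫ x, Real.exp (-u * x) ∂ν.restrict {0}ᶜ +
        (1 - ∑ i, rewardInit π T r i) := by
      have h3 := hint
      rw [hsplit] at h3
      conv_lhs => rw [hsplit]
      rw [integral_add_measure h3.left_of_add_measure h3.right_of_add_measure,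
        integral_smul_measure, integral_dirac, ENNReal.toReal_ofReal hdefect]
      simp
    linarith
  -- Intersecting with $\{0\}^c$ supplies the condition $0\notin A$ under which null sets carry no
  -- mass.
  · refine Measure.AbsolutelyContinuous.mk fun A hA hA0 => ?_
    rw [Measure.restrict_apply hA, hν, Measure.map_apply_of_aemeasurable hY
      (hA.inter (measurableSet_singleton 0).compl)]
    exact hJH.measure_totalReward_mem_eq_zero hT hπ0 hπ1 hr0
      (hA.inter (measurableSet_singleton 0).compl)
      (measure_mono_null Set.inter_subset_left hA0) (by simp)
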